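/- Let $T\in(0,\infty)$, $\xi_0\in\mathbb R$, and let $(W(t))_{t\ge0}$ be a real-valued standard Brownian motion on a probability space. Let $b,\sigma\colon\mathbb R\to\mathbb R$ be $C^\infty$ functions, each of whose derivatives of order $\ge1$ is bounded, and suppose there is $c>0$ with $|\sigma(x)y|\ge c|y|$ for all $x,y\in\mathbb R$. Equip $C([0,T],\mathbb R)$ with the supremum norm and let $f\in C^2_p(C([0,T],\mathbb R),\mathbb R)$, i.e. $f$ is twice continuously Fréchet differentiable and there are $K,q\ge1$ such that $\|D^kf(u)\|\le K(1+\|u\|^q)$ for all $u$ and $k\in\{0,1,2\}$. For discretization times $0=\tau_0<\tau_1<\dots<\tau_N=T$ with maximal step size $\delta=\max_{0\le n<N}(\tau_{n+1}-\tau_n)$, let $Y(\tau_0)=\xi_0$ and $$Y(\tau_{n+1})=Y(\tau_n)+b(Y(\tau_n))(\tau_{n+1}-\tau_n)+\sigma(Y(\tau_n))(W(\tau_{n+1})-W(\tau_n)),\qquad 0\le n<N,$$ be the explicit Euler scheme. For $0\le n<N$ and $t\in[\tau_n,\tau_{n+1}]$ define the piecewise linear interpolation $$Y(t)=Y(\tau_n)+\frac{t-\tau_n}{\tau_{n+1}-\tau_n}\bigl(Y(\tau_{n+1})-Y(\tau_n)\bigr)$$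 and the stochastic interpolation $$\tilde X(t)=Y(\tau_n)+\int_{\tau_n}^t b(Y(\tau_n))\,\mathrm ds+\int_{\tau_n}^t\sigma(Y(\tau_n))\,\mathrm dW(s),$$ and let $Y_T,\tilde X_T$ be the corresponding $C([0,T],\mathbb R)$-valued random variables. Then there is a constant $C\in(0,\infty)$, not depending on the discretization times, such that for all discretizations with $\delta\in(0,1]$ the random variables $f(Y_T)$ and $f(\tilde X_T)$ are integrable and $$\bigl|\mathbb E\bigl(f(Y_T)-f(\tilde X_T)\bigr)\bigr|\le C\delta .$$ -/

import Mathlib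

open MeasureTheory ProbabilityTheory Set
open scoped NNReal

noncomputable section

namespace EulerWeak

/-- `g ∈ C^n_p(U, V)`: `g` is `n` times continuously Fréchet differentiable and `g` and its
derivatives up to order `n` have at most polynomial growth. -/
def PolyGrowthContDiff {U V : Type*} [NormedAddCommGroup U] [NormedSpace ℝ U]
    [NormedAddCommGroup V] [NormedSpace ℝ V] (n : ℕ) (g : U → V) : Prop :=
  ContDiff ℝ n g ∧
    ∃ C q : ℝ, 1 ≤ C ∧ 1 ≤ q ∧
      ∀ k ≤ n, ∀ u : U, ‖iteratedFDeriv ℝ k g u‖ ≤ C * (1 + ‖u‖ ^ q)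

/-- A real function of class `C^∞` each of whose derivatives of order `≥ 1` is bounded. -/
def SmoothBoundedDerivs (g : ℝ → ℝ) : Prop :=
  ContDiff ℝ ((⊤ : ℕ∞) : WithTop ℕ∞) g ∧ ∀ k : ℕ, 1 ≤ k → ∃ M : ℝ, ∀ x : ℝ, |iteratedDeriv k g x| ≤ M

/-- The assumption on the coefficients of the SDE `dX = b(X) dt + σ(X) dW`, in dimension one:
`b` and `σ` are smooth with bounded derivatives, and `σ` is uniformly non-degenerate. -/
structure CoefficientAssumption (b σ : ℝ → ℝ) : Prop where
  drift : SmoothBoundedDerivs b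
  diffusion : SmoothBoundedDerivs σ
  nondegenerate : ∃ c : ℝ, 0 < c ∧ ∀ x y : ℝ, c * |y| ≤ |σ x * y|

/-- Discretization times `0 = τ 0 < τ 1 < ⋯ < τ N = T`. Values `τ n` with `n > N` play no role. -/
structure TimeGrid (T : ℝ) where
  N : ℕ
  τ : ℕ → ℝ
  τ_zero : τ 0 = 0
  τ_last : τ N = T
  τ_lt : ∀ n < N, τ n < τ (n + 1)

/-- The maximal step size `δ` of the grid. The supremum is a maximum over a finite set, which is
nonempty when `T > 0`. -/
def TimeGrid.mesh {T : ℝ} (G : TimeGrid T) : ℝ :=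
  ⨆ n : Fin G.N, (G.τ ((n : ℕ) + 1) - G.τ n)

/-- The index `n ∈ {0, …, N - 1}` of a grid interval `[τ n, τ (n+1)]` that contains `t ∈ [0, T]`:
the largest `n ≤ N - 1` such that `τ n ≤ t`. -/
def TimeGrid.index {T : ℝ} (G : TimeGrid T) (t : ℝ) : ℕ :=
  open Classical in Nat.findGreatest (fun n => G.τ n ≤ t) (G.N - 1)

section Scheme

variable {T : ℝ} (b σ : ℝ → ℝ) (ξ₀ : ℝ) (G : TimeGrid T) (w : ℝ≥0 → ℝ)

/-- The explicit Euler scheme driven by the trajectory `w`: the values `Y(τ n)`. -/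
def eulerNode : ℕ → ℝ
  | 0 => ξ₀
  | n + 1 => eulerNode n + b (eulerNode n) * (G.τ (n + 1) - G.τ n)
      + σ (eulerNode n) * (w (G.τ (n + 1)).toNNReal - w (G.τ n).toNNReal)

/-- The elementary stochastic integral `∫_s^t η dW`, along the trajectory `w`, of an integrand `η`
that does not depend on the integration time (and is known at time `s`). -/
def elementaryIntegral (η s t : ℝ) : ℝ := η * (w t.toNNReal - w s.toNNReal)

/-- The formula for the piecewise linear interpolation on `[τ n, τ (n+1)]`. -/
def linearPiece (n : ℕ) (t : ℝ) : ℝ :=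
  eulerNode b σ ξ₀ G w n + (t - G.τ n) / (G.τ (n + 1) - G.τ n) *
    (eulerNode b σ ξ₀ G w (n + 1) - eulerNode b σ ξ₀ G w n)

/-- The formula for the stochastic interpolation on `[τ n, τ (n+1)]`. -/
def stochasticPiece (n : ℕ) (t : ℝ) : ℝ :=
  eulerNode b σ ξ₀ G w n + (∫ _s in (G.τ n)..t, b (eulerNode b σ ξ₀ G w n))
    + elementaryIntegral w (σ (eulerNode b σ ξ₀ G w n)) (G.τ n) t

/-- The piecewise linear interpolation `Y(t)`, `t ∈ [0, T]`. -/
def linearInterp (t : ℝ) : ℝ := linearPiece b σ ξ₀ G w (G.index t) t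

/-- The stochastic interpolation `X̃(t)`, `t ∈ [0, T]`. -/
def stochasticInterp (t : ℝ) : ℝ := stochasticPiece b σ ξ₀ G w (G.index t) t

end Scheme

/-- The element of `C([0, T], ℝ)` given by the restriction of `g` to `[0, T]`
(with the value `0` if this restriction is not continuous). -/
def toPath (T : ℝ) (g : ℝ → ℝ) : C(Icc (0 : ℝ) T, ℝ) :=
  open Classical in
  if h : ContinuousOn g (Icc 0 T) then ⟨(Icc 0 T).domRestrict g, h.domRestrict⟩ else 0

section Processes

variable {Ω : Type*} {T : ℝ} (b σ : ℝ → ℝ) (ξ₀ : ℝ) (W : ℝ≥0 → Ω → ℝ) (G : TimeGrid T)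

/-- The `C([0, T], ℝ)`-valued random variable `Y_T`. -/
def linearPath (ω : Ω) : C(Icc (0 : ℝ) T, ℝ) :=
  toPath T (linearInterp b σ ξ₀ G (fun s => W s ω))

/-- The `C([0, T], ℝ)`-valued random variable `X̃_T`. -/
def stochasticPath (ω : Ω) : C(Icc (0 : ℝ) T, ℝ) :=
  toPath T (stochasticInterp b σ ξ₀ G (fun s => W s ω))

end Processes

/-! The interpolations are given by the two formulas on every closed grid interval, and they are
continuous (the stochastic one whenever the driving trajectory is), so that the default value in
`toPath` is attained at most on a null set. -/

section Consistency

variable {T : ℝ} (b σ : ℝ → ℝ) (ξ₀ : ℝ) (G : TimeGrid T) (w : ℝ≥0 → ℝ)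

theorem TimeGrid.τ_lt_of_lt {m n : ℕ} (hmn : m < n) (hn : n ≤ G.N) : G.τ m < G.τ n := by
  induction n, hmn using Nat.le_induction with
  | base => exact G.τ_lt m (by omega)
  | succ k hk ih => exact (ih (by omega)).trans (G.τ_lt k (by omega))

theorem TimeGrid.index_eq {n : ℕ} (hn : n < G.N) {t : ℝ} (ht : t ∈ Icc (G.τ n) (G.τ (n + 1))) :
    G.index t = n ∨ (G.index t = n + 1 ∧ t = G.τ (n + 1)) := by
  classical
  have h1 : n ≤ G.index t := Nat.le_findGreatest (by omega) ht.1
  have h2 : G.index t ≤ G.N - 1 := Nat.findGreatest_le _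
  have h3 : G.τ (G.index t) ≤ t :=
    Nat.findGreatest_spec (P := fun n => G.τ n ≤ t) (m := n) (by omega) ht.1
  rcases h1.eq_or_lt with h | h
  · exact Or.inl h.symm
  · right
    have h4 : G.index t = n + 1 := by
      by_contra hne
      have := G.τ_lt_of_lt (m := n + 1) (n := G.index t) (by omega) (by omega)
      linarith [ht.2]
    exact ⟨h4, le_antisymm ht.2 (h4 ▸ h3)⟩

theorem linearInterp_eq {n : ℕ} (hn : n < G.N) {t : ℝ}
    (ht : t ∈ Icc (G.τ n) (G.τ (n + 1))) :
    linearInterp b σ ξ₀ G w t = linearPiece b σ ξ₀ G w n t := by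
  rcases G.index_eq hn ht with h | ⟨h, h'⟩
  · rw [linearInterp, h]
  · have h0 : G.τ (n + 1) - G.τ n ≠ 0 := (sub_pos.2 (G.τ_lt n hn)).ne'
    rw [linearInterp, h, h', linearPiece, linearPiece, div_self h0]
    ring

theorem stochasticInterp_eq {n : ℕ} (hn : n < G.N) {t : ℝ}
    (ht : t ∈ Icc (G.τ n) (G.τ (n + 1))) :
    stochasticInterp b σ ξ₀ G w t = stochasticPiece b σ ξ₀ G w n t := by
  rcases G.index_eq hn ht with h | ⟨h, h'⟩
  · rw [stochasticInterp, h]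
  · rw [stochasticInterp, h, h', stochasticPiece, stochasticPiece, eulerNode]
    simp only [elementaryIntegral, intervalIntegral.integral_const, smul_eq_mul]
    ring

theorem TimeGrid.continuousOn_of_pieces {g : ℝ → ℝ}
    (hg : ∀ n < G.N, ContinuousOn g (Icc (G.τ n) (G.τ (n + 1)))) :
    ContinuousOn g (Icc 0 T) := by
  have key : ∀ n ≤ G.N, ContinuousOn g (Icc (G.τ 0) (G.τ n)) := by
    intro n
    induction n with
    | zero => intro _; simp
    | succ k ih =>
      intro hk
      have h0 : G.τ 0 ≤ G.τ k := by
        rcases Nat.eq_zero_or_pos k with h | h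
        · rw [h]
        · exact (G.τ_lt_of_lt h (by omega)).le
      rw [← Icc_union_Icc_eq_Icc h0 (G.τ_lt k (by omega)).le]
      exact (ih (by omega)).union_of_isClosed (hg k (by omega)) isClosed_Icc isClosed_Icc
  have := key G.N le_rfl
  rwa [G.τ_zero, G.τ_last] at this

theorem continuousOn_linearInterp : ContinuousOn (linearInterp b σ ξ₀ G w) (Icc 0 T) := by
  refine G.continuousOn_of_pieces fun n hn => ?_
  refine ContinuousOn.congr (f := linearPiece b σ ξ₀ G w n) ?_
    fun t ht => linearInterp_eq b σ ξ₀ G w hn ht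
  unfold linearPiece
  fun_prop

theorem continuousOn_stochasticInterp (hw : Continuous w) :
    ContinuousOn (stochasticInterp b σ ξ₀ G w) (Icc 0 T) := by
  refine G.continuousOn_of_pieces fun n hn => ?_
  refine ContinuousOn.congr (f := stochasticPiece b σ ξ₀ G w n) ?_
    fun t ht => stochasticInterp_eq b σ ξ₀ G w hn ht
  unfold stochasticPiece elementaryIntegral
  simp only [intervalIntegral.integral_const, smul_eq_mul]
  fun_prop

end Consistency

end EulerWeak

end

/-! On each grid interval the drift part of `X̃` is linear in time and so agrees with that of `Y`.
Hence `X̃ - Y` is `σ(Y(τ n))` times the Brownian bridge of `W` on that interval. The bridges are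
jointly Gaussian and uncorrelated with the grid increments, hence independent of them. Conditionally
on those increments, `Y` is a fixed path `u` and `X̃ = u + Z` with `Z` a centred Gaussian path.

For such a `Z`, with `Z'` an independent copy, `E f(u + Z) - f(u) = ∫₀¹ ½ E D²f(u + √s Z)(Z', Z')
ds`: the first order term vanishes (`abs_integral_sub_le_of_trace_le`). It remains to bound `E A(Z',
Z')` by a multiple of `δ ‖A‖` for a bilinear form `A`. Estimating by `‖A‖ E ‖Z'‖²` would in general
cost a logarithm, since `‖Z'‖` is a maximum over many independent bridges. Instead, independence
removes the cross terms, and the law of a bridge depends on its interval only through the length, so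
every piece may be replaced by a rescaling of one common bridge (`integral_diag_bridgeValues`). A
choice of signs dominates the sum of diagonal terms by the form at a single signed sum
(`abs_sum_diag_le`). The summands have disjoint supports, so the sup norm of that sum is a maximum,
of order `√δ` times the norm of the common bridge.

Bridges are replaced by Bernstein combinations of finitely many of their values, so that covariances
become finite sums; the degree is sent to infinity in `weakError_le`. Polynomial growth is absorbed
by moments of `sup |Y|` and `sup |W|` that are uniform in the grid
(`exists_lintegral_norm_linearOfIncr_le`, `exists_lintegral_norm_scaledPath_le`). They come from a
Lyapunov estimate for a stopped Euler chain. -/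

noncomputable section

namespace EulerWeak

open Filter Topology
open scoped ENNReal

/-! ### Symmetric second differences of a `C²` function. -/

section SecondDifference

variable {E : Type*} [NormedAddCommGroup E] [NormedSpace ℝ E] {f : E → ℝ}

/-- The symmetric second difference of `f` at `u` in direction `y` with step `r`. -/
def secondDiff (f : E → ℝ) (u y : E) (r : ℝ) : ℝ := f (u + r • y) + f (u - r • y) - 2 * f u

theorem hasDerivAt_secondDiff (hf : ContDiff ℝ 2 f) (u y : E) (r : ℝ) :
    HasDerivAt (secondDiff f u y) (fderiv ℝ f (u + r • y) y - fderiv ℝ f (u - r • y) y) r := by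
  have hd : Differentiable ℝ f := hf.differentiable (by norm_num)
  have h1 : HasDerivAt (fun r : ℝ => u + r • y) y r := by
    simpa using ((hasDerivAt_id r).smul_const y).const_add u
  have h2 : HasDerivAt (fun r : ℝ => u - r • y) (-y) r := by
    simpa using ((hasDerivAt_id r).smul_const y).const_sub u
  have h3 := ((hd _).hasFDerivAt.comp_hasDerivAt r h1).add
    ((hd _).hasFDerivAt.comp_hasDerivAt r h2)
  have h4 := h3.sub_const (2 * f u)
  simp only [map_neg, ← sub_eq_add_neg] at h4
  exact h4

theorem differentiable_fderiv_of_contDiff_two (hf : ContDiff ℝ 2 f) :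
    Differentiable ℝ (fderiv ℝ f) :=
  (hf.fderiv_right (m := 1) (by norm_num)).differentiable (by norm_num)

/-- Two mean value inequalities: one for `fderiv ℝ f` on the ball bounds the derivative in the step
by `2 r ‖y‖² B`, the other integrates this bound. The constant is not sharp; what matters is the
factor `r ^ 2`, which gives domination after division by the time step. -/
theorem abs_secondDiff_le (hf : ContDiff ℝ 2 f) (u y : E) {B r : ℝ} (hr : 0 ≤ r)
    (hB : ∀ v ∈ Metric.closedBall u (r * ‖y‖), ‖fderiv ℝ (fderiv ℝ f) v‖ ≤ B) :
    |secondDiff f u y r| ≤ 2 * r ^ 2 * ‖y‖ ^ 2 * B := by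
  have hB0 : 0 ≤ B := le_trans (by positivity) (hB u (Metric.mem_closedBall_self (by positivity)))
  have hd := differentiable_fderiv_of_contDiff_two hf
  have key : ∀ x ∈ Icc (0 : ℝ) r, ‖fderiv ℝ f (u + x • y) y - fderiv ℝ f (u - x • y) y‖
      ≤ 2 * r * ‖y‖ ^ 2 * B := by
    intro x hx
    have hmem : ∀ z : E, ‖z‖ ≤ x * ‖y‖ → u + z ∈ Metric.closedBall u (r * ‖y‖) := by
      intro z hz
      rw [mem_closedBall_iff_norm, add_sub_cancel_left]
      exact hz.trans (mul_le_mul_of_nonneg_right hx.2 (norm_nonneg _))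
    have h1 : u + x • y ∈ Metric.closedBall u (r * ‖y‖) :=
      hmem _ (by rw [norm_smul, Real.norm_of_nonneg hx.1])
    have h2 : u - x • y ∈ Metric.closedBall u (r * ‖y‖) := by
      rw [sub_eq_add_neg]
      exact hmem _ (by rw [norm_neg, norm_smul, Real.norm_of_nonneg hx.1])
    have h3 := (convex_closedBall u (r * ‖y‖)).norm_image_sub_le_of_norm_fderiv_le
      (fun v _ => hd v) hB h2 h1
    have h4 : u + x • y - (u - x • y) = (2 * x) • y := by module
    rw [h4, norm_smul, Real.norm_of_nonneg (by linarith [hx.1])] at h3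
    calc _ = ‖(fderiv ℝ f (u + x • y) - fderiv ℝ f (u - x • y)) y‖ := rfl
      _ ≤ (B * (2 * x * ‖y‖)) * ‖y‖ := (ContinuousLinearMap.le_opNorm _ _).trans (by gcongr)
      _ = x * (2 * ‖y‖ ^ 2 * B) := by ring
      _ ≤ r * (2 * ‖y‖ ^ 2 * B) := mul_le_mul_of_nonneg_right hx.2 (by positivity)
      _ = _ := by ring
  have h := (convex_Icc (0 : ℝ) r).norm_image_sub_le_of_norm_hasDerivWithin_le
    (fun x _ => (hasDerivAt_secondDiff hf u y x).hasDerivWithinAt) key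
    (left_mem_Icc.2 hr) (right_mem_Icc.2 hr)
  have h0 : secondDiff f u y 0 = 0 := by simp [secondDiff]; ring
  rw [h0, sub_zero, sub_zero, Real.norm_eq_abs, Real.norm_of_nonneg hr] at h
  exact h.trans_eq (by ring)

/-- By L'Hôpital's rule it suffices to differentiate `fderiv ℝ f (u ± r • y) y` at `r = 0`, so no
Taylor formula is needed. -/
theorem tendsto_secondDiff_div_sq (hf : ContDiff ℝ 2 f) (u y : E) :
    Tendsto (fun r => secondDiff f u y r / r ^ 2) (𝓝[>] 0)
      (𝓝 (fderiv ℝ (fderiv ℝ f) u y y)) := by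
  have hd := differentiable_fderiv_of_contDiff_two hf
  refine HasDerivAt.lhopital_zero_nhdsGT
    (Eventually.of_forall fun r => hasDerivAt_secondDiff hf u y r)
    (Eventually.of_forall fun r => hasDerivAt_pow 2 r) ?_ ?_ ?_ ?_
  · filter_upwards [self_mem_nhdsWithin] with r hr
    have : (0 : ℝ) < r := hr
    simp [this.ne']
  · have h := (hasDerivAt_secondDiff hf u y 0).continuousAt.tendsto
    have h0 : secondDiff f u y 0 = 0 := by simp [secondDiff]; ring
    rw [h0] at h
    exact h.mono_left nhdsWithin_le_nhds
  · have : Tendsto (fun r : ℝ => r ^ 2) (𝓝 0) (𝓝 (0 ^ 2)) := (continuous_pow 2).tendsto 0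
    simpa using this.mono_left nhdsWithin_le_nhds
  · have h1 : HasDerivAt (fun r : ℝ => u + r • y) y 0 := by
      simpa using ((hasDerivAt_id (0 : ℝ)).smul_const y).const_add u
    have h2 : HasDerivAt (fun r : ℝ => u - r • y) (-y) 0 := by
      simpa using ((hasDerivAt_id (0 : ℝ)).smul_const y).const_sub u
    have h3 : HasDerivAt (fun r : ℝ => fderiv ℝ f (u + r • y) y - fderiv ℝ f (u - r • y) y)
        (fderiv ℝ (fderiv ℝ f) u y y - fderiv ℝ (fderiv ℝ f) u (-y) y) 0 := by
      have e1 := (hd (u + (0 : ℝ) • y)).hasFDerivAt.comp_hasDerivAt (0 : ℝ) h1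
      have e2 := (hd (u - (0 : ℝ) • y)).hasFDerivAt.comp_hasDerivAt (0 : ℝ) h2
      have e3 := (e1.clm_apply (hasDerivAt_const (0 : ℝ) y)).sub
        (e2.clm_apply (hasDerivAt_const (0 : ℝ) y))
      refine e3.congr_deriv ?_
      simp
    have h4 := h3.tendsto_slope_zero_right
    have h5 : fderiv ℝ (fderiv ℝ f) u y y
        = (fderiv ℝ (fderiv ℝ f) u y y - fderiv ℝ (fderiv ℝ f) u (-y) y) / 2 := by
      simp
    rw [h5]
    refine (h4.div_const 2).congr' ?_
    filter_upwards [self_mem_nhdsWithin] with r hr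
    have : (0 : ℝ) < r := hr
    simp
    field_simp

end SecondDifference

/-! ### Interpolation along the scale of a centred Gaussian measure. -/

section GaussianInterpolation

variable {E : Type*} [NormedAddCommGroup E] [NormedSpace ℝ E] [MeasurableSpace E] [BorelSpace E]
  [SecondCountableTopology E] [CompleteSpace E] {f : E → ℝ} {κ : Measure E} [IsGaussian κ]

/-- The pair `(a, b)` is `|c| (cos θ, sin θ)`, and the product of two copies of a centred Gaussian
measure is invariant under rotation by `θ`. -/
theorem map_prod_smul_add_smul_of_sq_add_sq (hκ : ∫ x, x ∂κ = 0) {a b c : ℝ}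
    (h : a ^ 2 + b ^ 2 = c ^ 2) :
    (κ.prod κ).map (fun p : E × E => a • p.1 + b • p.2) = κ.map (fun x => c • x) := by
  obtain ⟨θ, ha, hb⟩ : ∃ θ : ℝ, a = |c| * Real.cos θ ∧ b = |c| * Real.sin θ := by
    have hn : ‖(⟨a, b⟩ : ℂ)‖ = |c| := by
      rw [Complex.norm_eq_sqrt_sq_add_sq]; simp [h, Real.sqrt_sq_eq_abs]
    refine ⟨Complex.arg ⟨a, b⟩, ?_, ?_⟩
    · rw [← hn, Complex.norm_mul_cos_arg]
    · rw [← hn, Complex.norm_mul_sin_arg]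
  have habs : κ.map (fun x => |c| • x) = κ.map (fun x => c • x) := by
    -- For negative `c` the sign is removed by the symmetry of `κ`, which is rotation by `π`.
    rcases abs_choice c with hc | hc
    · rw [hc]
    · have hneg : κ.map (fun x => (-1 : ℝ) • x) = κ := by
        have h1 := IsGaussian.map_rotation_eq_self (μ := κ) hκ Real.pi
        have h2 := congrArg (fun μ => μ.map Prod.fst) h1
        rw [Measure.map_map (by fun_prop) (by fun_prop), Measure.map_fst_prod] at h2
        have h3 : Prod.fst ∘ (ContinuousLinearMap.rotation Real.pi : E × E →L[ℝ] E × E)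
            = (fun x : E => (-1 : ℝ) • x) ∘ Prod.fst := by
          ext p; simp [ContinuousLinearMap.rotation_apply]
        rw [h3, ← Measure.map_map (by fun_prop) (by fun_prop), Measure.map_fst_prod] at h2
        simpa using h2
      rw [hc]
      conv_rhs => rw [← hneg]
      rw [Measure.map_map (by fun_prop) (by fun_prop)]
      congr 1
      ext x; simp
  have h1 := IsGaussian.map_rotation_eq_self (μ := κ) hκ θ
  have h2 := congrArg (fun μ => μ.map (fun p : E × E => |c| • p.1)) h1
  rw [Measure.map_map (by fun_prop) (by fun_prop)] at h2
  have h3 : (fun p : E × E => |c| • p.1) ∘ (ContinuousLinearMap.rotation θ : E × E →L[ℝ] E × E)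
      = fun p : E × E => a • p.1 + b • p.2 := by
    ext p; simp [ContinuousLinearMap.rotation_apply, ha, hb, smul_add, smul_smul]
  rw [h3] at h2
  rw [h2, ← habs]
  have h4 : (fun p : E × E => |c| • p.1) = (fun x : E => |c| • x) ∘ Prod.fst := rfl
  rw [h4, ← Measure.map_map (by fun_prop) (by fun_prop), Measure.map_fst_prod]
  simp

theorem integrable_one_add_norm_pow (c : ℝ) (hc : 0 ≤ c) (k : ℕ) :
    Integrable (fun x : E => (1 + c + ‖x‖) ^ k) κ := by
  have h : MemLp (fun x : E => 1 + c + ‖x‖) k κ :=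
    (memLp_const (1 + c)).add (IsGaussian.memLp_id κ k (by simp)).norm
  refine (h.integrable_norm_pow' ).congr (ae_of_all _ fun x => ?_)
  simp only
  rw [Real.norm_of_nonneg (by positivity)]

theorem integrable_one_add_norm_add_norm_pow (c : ℝ) (hc : 0 ≤ c) (k : ℕ) :
    Integrable (fun p : E × E => (1 + c + ‖p.1‖ + ‖p.2‖) ^ k) (κ.prod κ) := by
  have h0 : MemLp (fun x : E => ‖x‖) k κ := (IsGaussian.memLp_id κ k (by simp)).norm
  have h : MemLp (fun p : E × E => 1 + c + ‖p.1‖ + ‖p.2‖) k (κ.prod κ) :=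
    ((memLp_const (1 + c)).add (h0.comp_measurePreserving measurePreserving_fst)).add
      (h0.comp_measurePreserving measurePreserving_snd)
  refine (h.integrable_norm_pow' ).congr (ae_of_all _ fun x => ?_)
  simp only
  rw [Real.norm_of_nonneg (by positivity)]

/-- Let `φ s = E f(u + √s X)`. With `X'` an independent copy, `√(s+h) X` has the law of `√s X + √h
X'` and also of `√s X - √h X'`. Averaging the two makes the increment of `φ` a symmetric second
difference, so its right derivative is `½ E D²f(u + √s X)(X', X')`. The hypothesis `htr` bounds the
inner expectation, and the mean value inequality on `[0, 1]` needs only continuity and right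
derivatives. -/
theorem abs_integral_sub_le_of_trace_le (hκ : ∫ x, x ∂κ = 0) (hf : ContDiff ℝ 2 f) {K : ℝ} {k : ℕ}
    (hK : 0 ≤ K) (hf0 : ∀ u, |f u| ≤ K * (1 + ‖u‖) ^ k)
    (hf2 : ∀ u, ‖fderiv ℝ (fderiv ℝ f) u‖ ≤ K * (1 + ‖u‖) ^ k) {A : ℝ} (hA : 0 ≤ A)
    (htr : ∀ x, |∫ y, fderiv ℝ (fderiv ℝ f) x y y ∂κ| ≤ A * ‖fderiv ℝ (fderiv ℝ f) x‖) (u : E) :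
    |∫ x, f (u + x) ∂κ - f u| ≤ A * K * ∫ x, (1 + ‖u‖ + ‖x‖) ^ k ∂κ := by
  have hcf : Continuous f := hf.continuous
  have hcd := (hf.fderiv_right (m := 1) (by norm_num)).continuous_fderiv (by norm_num)
  set φ : ℝ → ℝ := fun s => ∫ x, f (u + √s • x) ∂κ with hφ
  have hsqrt : ∀ s ∈ Icc (0 : ℝ) 1, √s ≤ 1 := fun s hs => Real.sqrt_le_one.2 hs.2
  have hnorm : ∀ s ∈ Icc (0 : ℝ) 1, ∀ x : E, 1 + ‖u + √s • x‖ ≤ 1 + ‖u‖ + ‖x‖ := by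
    intro s hs x
    have h1 : ‖u + √s • x‖ ≤ ‖u‖ + √s * ‖x‖ := (norm_add_le _ _).trans_eq (by
      rw [norm_smul, Real.norm_of_nonneg (Real.sqrt_nonneg _)])
    nlinarith [hsqrt s hs, norm_nonneg x]
  have hbd : ∀ s ∈ Icc (0 : ℝ) 1, ∀ x : E, |f (u + √s • x)| ≤ K * (1 + ‖u‖ + ‖x‖) ^ k := by
    intro s hs x
    refine (hf0 _).trans ?_
    gcongr K * ?_ ^ k
    exact hnorm s hs x
  have hint : Integrable (fun x : E => (1 + ‖u‖ + ‖x‖) ^ k) κ :=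
    integrable_one_add_norm_pow _ (norm_nonneg u) k
  have hφint : ∀ s ∈ Icc (0 : ℝ) 1, Integrable (fun x => f (u + √s • x)) κ := fun s hs =>
    (hint.const_mul K).mono' (by fun_prop) (ae_of_all _ fun x => hbd s hs x)
  have hφc : ContinuousOn φ (Icc 0 1) := by
    refine continuousOn_of_dominated (bound := fun x => K * (1 + ‖u‖ + ‖x‖) ^ k)
      (fun s _ => by fun_prop) (fun s hs => ae_of_all _ fun x => hbd s hs x)
      (hint.const_mul K) (ae_of_all _ fun x => ?_)
    fun_prop
  set φ' : ℝ → ℝ := fun s =>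
    2⁻¹ * ∫ x, ∫ y, fderiv ℝ (fderiv ℝ f) (u + √s • x) y y ∂κ ∂κ with hφ'
  have hφ'le : ∀ s ∈ Ico (0 : ℝ) 1, ‖φ' s‖ ≤ A * K * ∫ x, (1 + ‖u‖ + ‖x‖) ^ k ∂κ := by
    intro s hs
    have hs' := Ico_subset_Icc_self hs
    have h1 : ‖∫ x, ∫ y, fderiv ℝ (fderiv ℝ f) (u + √s • x) y y ∂κ ∂κ‖
        ≤ ∫ x, A * K * (1 + ‖u‖ + ‖x‖) ^ k ∂κ := by
      refine norm_integral_le_of_norm_le (hint.const_mul _) (ae_of_all _ fun x => ?_)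
      refine (htr _).trans ?_
      rw [mul_assoc]
      refine mul_le_mul_of_nonneg_left ((hf2 _).trans ?_) hA
      gcongr K * ?_ ^ k
      exact hnorm s hs' x
    rw [integral_const_mul] at h1
    rw [hφ', norm_mul]
    have h2 := norm_nonneg (∫ x, ∫ y, fderiv ℝ (fderiv ℝ f) (u + √s • x) y y ∂κ ∂κ)
    have h3 : ‖(2⁻¹ : ℝ)‖ ≤ 1 := by norm_num
    exact (mul_le_of_le_one_left h2 h3).trans h1
  have hφd : ∀ s ∈ Ico (0 : ℝ) 1, HasDerivWithinAt φ (φ' s) (Ici s) s := by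
    intro s hs
    have hs' := Ico_subset_Icc_self hs
    -- The exponent is `k` for the growth of the second derivative plus `2` for the squared
    -- direction.
    have hII := integrable_one_add_norm_add_norm_pow (κ := κ) ‖u‖ (norm_nonneg u) (k + 2)
    -- bounds for the second difference
    have hb : ∀ h ∈ Ioc (0 : ℝ) 1, ∀ p : E × E, |secondDiff f (u + √s • p.1) p.2 √h / h|
        ≤ 2 * K * (1 + ‖u‖ + ‖p.1‖ + ‖p.2‖) ^ (k + 2) := by
      intro h hh p
      have hh0 : 0 < h := hh.1
      have h1 := abs_secondDiff_le hf (u + √s • p.1) p.2 (r := √h)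
        (B := K * (1 + ‖u‖ + ‖p.1‖ + ‖p.2‖) ^ k) (Real.sqrt_nonneg _) (by
          intro v hv
          rw [mem_closedBall_iff_norm] at hv
          refine (hf2 v).trans ?_
          gcongr K * ?_ ^ k
          have h2 : ‖v‖ ≤ ‖u + √s • p.1‖ + ‖v - (u + √s • p.1)‖ := by
            have := norm_add_le (u + √s • p.1) (v - (u + √s • p.1))
            simpa using this
          have h3 : √h * ‖p.2‖ ≤ 1 * ‖p.2‖ :=
            mul_le_mul_of_nonneg_right (hsqrt h ⟨hh0.le, hh.2⟩) (norm_nonneg _)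
          linarith [hnorm s hs' p.1])
      rw [Real.sq_sqrt hh0.le] at h1
      rw [abs_div, abs_of_pos hh0, div_le_iff₀ hh0]
      refine h1.trans ?_
      have h4 : ‖p.2‖ ^ 2 ≤ (1 + ‖u‖ + ‖p.1‖ + ‖p.2‖) ^ 2 := by
        gcongr
        have := norm_nonneg u; have := norm_nonneg p.1; linarith
      calc 2 * h * ‖p.2‖ ^ 2 * (K * (1 + ‖u‖ + ‖p.1‖ + ‖p.2‖) ^ k)
          ≤ 2 * h * (1 + ‖u‖ + ‖p.1‖ + ‖p.2‖) ^ 2 * (K * (1 + ‖u‖ + ‖p.1‖ + ‖p.2‖) ^ k) := by gcongr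
        _ = _ := by ring
    have hlim : Tendsto (fun h : ℝ => ∫ p : E × E, secondDiff f
      (u + √s • p.1) p.2 √h / h ∂(κ.prod κ))
        (𝓝[>] 0) (𝓝 (∫ p : E × E, fderiv ℝ (fderiv ℝ f) (u + √s • p.1) p.2 p.2 ∂(κ.prod κ))) := by
      refine tendsto_integral_filter_of_dominated_convergence
        (fun p => 2 * K * (1 + ‖u‖ + ‖p.1‖ + ‖p.2‖) ^ (k + 2)) ?_ ?_ (hII.const_mul _) ?_
      · refine Eventually.of_forall fun h => ?_
        unfold secondDiff
        exact Continuous.aestronglyMeasurable (by fun_prop)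
      · filter_upwards [Ioc_mem_nhdsGT (zero_lt_one (α := ℝ))] with h hh
        exact ae_of_all _ fun p => hb h hh p
      · refine ae_of_all _ fun p => ?_
        have h1 := tendsto_secondDiff_div_sq hf (u + √s • p.1) p.2
        have h2 : Tendsto (fun h : ℝ => √h) (𝓝[>] 0) (𝓝[>] 0) := by
          refine tendsto_nhdsWithin_iff.2 ⟨?_, ?_⟩
          · have := (Real.continuous_sqrt.tendsto 0).mono_left
              (nhdsWithin_le_nhds (s := Ioi (0 : ℝ)))
            simpa using this
          · filter_upwards [self_mem_nhdsWithin] with h hh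
            exact Real.sqrt_pos.2 hh
        refine (h1.comp h2).congr' ?_
        filter_upwards [self_mem_nhdsWithin] with h hh
        simp only [Function.comp_apply]
        rw [Real.sq_sqrt (le_of_lt hh)]
    have hD2int : Integrable (fun p : E × E => fderiv ℝ (fderiv ℝ f) (u + √s • p.1) p.2 p.2)
        (κ.prod κ) := by
      refine (hII.const_mul K).mono' (Continuous.aestronglyMeasurable (by fun_prop))
        (ae_of_all _ fun p => ?_)
      calc ‖fderiv ℝ (fderiv ℝ f) (u + √s • p.1) p.2 p.2‖
          ≤ ‖fderiv ℝ (fderiv ℝ f) (u + √s • p.1)‖ * ‖p.2‖ * ‖p.2‖ :=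
            ContinuousLinearMap.le_opNorm₂ _ _ _
        _ ≤ (K * (1 + ‖u + √s • p.1‖) ^ k) * ‖p.2‖ * ‖p.2‖ := by gcongr; exact hf2 _
        _ ≤ (K * (1 + ‖u‖ + ‖p.1‖ + ‖p.2‖) ^ k) * (1 + ‖u‖ + ‖p.1‖ + ‖p.2‖)
            * (1 + ‖u‖ + ‖p.1‖ + ‖p.2‖) := by
            have h1 := hnorm s hs' p.1
            have h2 := norm_nonneg u
            have h3 := norm_nonneg p.1
            have h4 := norm_nonneg p.2
            gcongr ?_ * ?_ * ?_
            · gcongr K * ?_ ^ k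
              linarith
            · linarith
            · linarith
        _ = _ := by ring
    -- Stated for any `b` with `b ^ 2 = h`, so that it applies to both `√h` and `-√h`.
    have hrot : ∀ h ∈ Ioo (0 : ℝ) (1 - s), ∀ b : ℝ, b ^ 2 = h →
        φ (s + h) = ∫ p : E × E, f (u + √s • p.1 + b • p.2) ∂(κ.prod κ) ∧
        Integrable (fun p : E × E => f (u + √s • p.1 + b • p.2)) (κ.prod κ) := by
      intro h hh b hb'
      have hsh : s + h ∈ Icc (0 : ℝ) 1 := ⟨by linarith [hs.1, hh.1], by linarith [hh.2]⟩
      have hmap := map_prod_smul_add_smul_of_sq_add_sq (κ := κ) hκ (a := √s) (b := b)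
        (c := √(s + h)) (by rw [Real.sq_sqrt hs.1, Real.sq_sqrt hsh.1, hb'])
      have hi : Integrable (fun z => f (u + z)) (κ.map (fun x => √(s + h) • x)) :=
        (integrable_map_measure (f := fun x => √(s + h) • x) (g := fun z => f (u + z))
          (by fun_prop) (by fun_prop)).2 (hφint _ hsh)
      have he : φ (s + h) = ∫ z, f (u + z) ∂(κ.map (fun x => √(s + h) • x)) :=
        by rw [integral_map (by fun_prop) (by fun_prop)]
      rw [← hmap] at hi he
      rw [integral_map (by fun_prop) (by fun_prop)] at he
      have hi' := (integrable_map_measure (by fun_prop) (by fun_prop)).1 hi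
      simp only [Function.comp_def, ← add_assoc] at he hi'
      exact ⟨he, hi'⟩
    have hslope : ∀ h ∈ Ioo (0 : ℝ) (1 - s), slope φ s (s + h)
        = 2⁻¹ * ∫ p : E × E, secondDiff f (u + √s • p.1) p.2 √h / h ∂(κ.prod κ) := by
      intro h hh
      obtain ⟨e1, i1⟩ := hrot h hh √h (Real.sq_sqrt hh.1.le)
      obtain ⟨e2, i2⟩ := hrot h hh (-√h) (by rw [neg_sq, Real.sq_sqrt hh.1.le])
      have i3 : Integrable (fun p : E × E => f (u + √s • p.1)) (κ.prod κ) :=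
        (hφint s hs').comp_fst κ
      have e3 : φ s = ∫ p : E × E, f (u + √s • p.1) ∂(κ.prod κ) := by
        rw [integral_prod _ i3]; simp [hφ]
      simp only [neg_smul, ← sub_eq_add_neg] at e2 i2
      have e4 : ∫ p : E × E, secondDiff f (u + √s • p.1) p.2 √h ∂(κ.prod κ)
          = φ (s + h) + φ (s + h) - 2 * φ s := by
        unfold secondDiff
        rw [integral_sub (by exact i1.add i2) (i3.const_mul 2), integral_add i1 i2,
          integral_const_mul,
          ← e1, ← e2, ← e3]
      rw [integral_div, e4, slope_def_field, add_sub_cancel_left]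
      have : h ≠ 0 := hh.1.ne'
      field_simp
      ring
    rw [← hasDerivWithinAt_Ioi_iff_Ici, hasDerivWithinAt_iff_tendsto_slope' (by simp)]
    have hφ's : φ' s = 2⁻¹ * ∫ p : E × E, fderiv ℝ (fderiv ℝ f)
      (u + √s • p.1) p.2 p.2 ∂(κ.prod κ) := by
      rw [integral_prod _ hD2int]
    rw [hφ's]
    have hshift : Tendsto (fun r : ℝ => r - s) (𝓝[>] s) (𝓝[>] 0) := by
      refine tendsto_nhdsWithin_iff.2 ⟨?_, ?_⟩
      · have : Tendsto (fun r : ℝ => r - s) (𝓝 s) (𝓝 (s - s)) :=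
          (continuous_id.sub continuous_const).tendsto s
        rw [sub_self] at this
        exact this.mono_left nhdsWithin_le_nhds
      · filter_upwards [self_mem_nhdsWithin] with r hr
        exact sub_pos.2 (show s < r from hr)
    refine ((hlim.const_mul 2⁻¹).comp hshift).congr' ?_
    filter_upwards [Ioo_mem_nhdsGT hs.2] with r hr
    have := hslope (r - s) ⟨by linarith [hr.1], by linarith [hr.2]⟩
    rw [add_sub_cancel] at this
    rw [this]
    rfl
  have := norm_image_sub_le_of_norm_deriv_right_le_segment hφc hφd hφ'le 1
    (right_mem_Icc.2 zero_le_one)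
  simpa [hφ] using this

end GaussianInterpolation

theorem one_add_rpow_le_two_mul_pow {t q : ℝ} (ht : 0 ≤ t) (hq : 0 ≤ q) :
    1 + t ^ q ≤ 2 * (1 + t) ^ ⌈q⌉₊ := by
  have h1 : t ^ q ≤ (1 + t) ^ ⌈q⌉₊ := by
    calc t ^ q ≤ (1 + t) ^ q := Real.rpow_le_rpow ht (by linarith) hq
      _ ≤ (1 + t) ^ (⌈q⌉₊ : ℝ) := Real.rpow_le_rpow_of_exponent_le (by linarith) (Nat.le_ceil q)
      _ = _ := Real.rpow_natCast _ _
  have h2 : 1 ≤ (1 + t) ^ ⌈q⌉₊ := one_le_pow₀ (by linarith)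
  linarith

theorem PolyGrowthContDiff.exists_pow_bound {E : Type*} [NormedAddCommGroup E] [NormedSpace ℝ E]
    {f : E → ℝ} (hf : PolyGrowthContDiff 2 f) :
    ∃ (K : ℝ) (k : ℕ), 0 ≤ K ∧ (∀ u, |f u| ≤ K * (1 + ‖u‖) ^ k) ∧
      ∀ u, ‖fderiv ℝ (fderiv ℝ f) u‖ ≤ K * (1 + ‖u‖) ^ k := by
  obtain ⟨_, C, q, hC, hq, hb⟩ := hf
  have key : ∀ j ≤ 2, ∀ u : E, ‖iteratedFDeriv ℝ j f u‖ ≤ 2 * C * (1 + ‖u‖) ^ ⌈q⌉₊ := by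
    intro j hj u
    refine (hb j hj u).trans ?_
    have := one_add_rpow_le_two_mul_pow (norm_nonneg u) (by linarith : (0 : ℝ) ≤ q)
    nlinarith
  refine ⟨2 * C, ⌈q⌉₊, by linarith, fun u => ?_, fun u => ?_⟩
  · simpa using key 0 (by norm_num) u
  · have h := key 2 le_rfl u
    rwa [← norm_iteratedFDeriv_fderiv, norm_iteratedFDeriv_one] at h

/-! ### Bounding a sum of diagonal terms by choosing signs. -/

section Signs

variable {V : Type*} [NormedAddCommGroup V] [NormedSpace ℝ V]

/-- The signs are chosen one at a time so that the two cross terms with the partial sum already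
built have a nonnegative total. The form need not be symmetric. -/
theorem exists_signs_sum_diag_le (A : V →L[ℝ] V →L[ℝ] ℝ) {ι : Type*} (s : Finset ι) (v : ι → V) :
    ∃ ε : ι → ℝ, (∀ i, |ε i| ≤ 1) ∧
      ∑ i ∈ s, A (v i) (v i) ≤ A (∑ i ∈ s, ε i • v i) (∑ i ∈ s, ε i • v i) := by
  classical
  induction s using Finset.induction_on with
  | empty => exact ⟨0, by simp, by simp⟩
  | insert a s ha ih =>
    obtain ⟨ε, hε, h⟩ := ih
    set S := ∑ i ∈ s, ε i • v i
    obtain ⟨c, hc, hc2, hcp⟩ : ∃ c : ℝ, |c| ≤ 1 ∧ c * c = 1 ∧ 0 ≤ c * (A S (v a) + A (v a) S) := by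
      rcases le_total 0 (A S (v a) + A (v a) S) with h0 | h0
      · exact ⟨1, by simp, by simp, by simpa using h0⟩
      · exact ⟨-1, by simp, by simp, by linarith⟩
    refine ⟨Function.update ε a c, fun i => ?_, ?_⟩
    · by_cases hi : i = a
      · simpa [hi] using hc
      · simpa [hi] using hε i
    · rw [Finset.sum_insert ha, Finset.sum_insert ha]
      have e : ∑ i ∈ s, Function.update ε a c i • v i = S :=
        Finset.sum_congr rfl fun i hi => by
          rw [Function.update_of_ne (ne_of_mem_of_not_mem hi ha)]
      rw [e]
      simp only [Function.update_self, map_add, map_smul, add_apply, smul_apply, smul_eq_mul]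
      linear_combination h + hcp - A (v a) (v a) * hc2

/-- This avoids a factor equal to the number of summands whenever the signed sums are no larger than
a single summand, as for functions with disjoint supports. -/
theorem abs_sum_diag_le (A : V →L[ℝ] V →L[ℝ] ℝ) {ι : Type*} (s : Finset ι) (v : ι → V) {R : ℝ}
    (hR : ∀ ε : ι → ℝ, (∀ i, |ε i| ≤ 1) → ‖∑ i ∈ s, ε i • v i‖ ≤ R) :
    |∑ i ∈ s, A (v i) (v i)| ≤ ‖A‖ * R ^ 2 := by
  have key : ∀ B : V →L[ℝ] V →L[ℝ] ℝ, ∑ i ∈ s, B (v i) (v i) ≤ ‖B‖ * R ^ 2 := by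
    intro B
    obtain ⟨ε, hε, h⟩ := exists_signs_sum_diag_le B s v
    refine h.trans ((le_abs_self _).trans ((B.le_opNorm₂ _ _).trans ?_))
    have := hR ε hε
    rw [mul_assoc, pow_two]
    gcongr
    exact (norm_nonneg _).trans this
  rw [abs_le]
  refine ⟨?_, key A⟩
  have := key (-A)
  have hn : ‖-A‖ = ‖A‖ := norm_neg A
  simp only [neg_apply, Finset.sum_neg_distrib] at this
  rw [hn] at this
  linarith

end Signs

/-! ### Localization to the intervals of a grid. -/

section GridMap

variable {T : ℝ} (G : TimeGrid T)

/-- The parametrization of `[τ n, τ (n + 1)]` by `[0, 1]`, extended to `[0, T]` by constants. -/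
def gridMap (n : ℕ) : C(Icc (0 : ℝ) T, unitInterval) where
  toFun t := projIcc 0 1 zero_le_one (((t : ℝ) - G.τ n) / (G.τ (n + 1) - G.τ n))
  continuous_toFun := by fun_prop

theorem TimeGrid.τ_le_of_le {m n : ℕ} (hmn : m ≤ n) (hn : n ≤ G.N) : G.τ m ≤ G.τ n := by
  rcases hmn.eq_or_lt with rfl | h
  · rfl
  · exact (G.τ_lt_of_lt h hn).le

theorem TimeGrid.τ_nonneg {n : ℕ} (hn : n ≤ G.N) : 0 ≤ G.τ n := by
  simpa [G.τ_zero] using G.τ_le_of_le (Nat.zero_le n) hn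

theorem TimeGrid.τ_le {n : ℕ} (hn : n ≤ G.N) : G.τ n ≤ T := by
  simpa [G.τ_last] using G.τ_le_of_le hn le_rfl

theorem TimeGrid.N_pos (hT : 0 < T) : 0 < G.N := by
  rcases Nat.eq_zero_or_pos G.N with h | h
  · have h1 := G.τ_last
    rw [h, G.τ_zero] at h1
    exact absurd h1 hT.ne
  · exact h

theorem TimeGrid.sub_le_mesh {n : ℕ} (hn : n < G.N) : G.τ (n + 1) - G.τ n ≤ G.mesh :=
  le_ciSup (f := fun n : Fin G.N => G.τ ((n : ℕ) + 1) - G.τ n) (Finite.bddAbove_range _) ⟨n, hn⟩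

theorem TimeGrid.exists_mem (hT : 0 < T) (t : Icc (0 : ℝ) T) :
    ∃ n < G.N, (t : ℝ) ∈ Icc (G.τ n) (G.τ (n + 1)) := by
  have key : ∀ m ≤ G.N, 0 < m → (t : ℝ) ≤ G.τ m → ∃ n < m, (t : ℝ) ∈ Icc (G.τ n) (G.τ (n + 1)) := by
    intro m
    induction m with
    | zero => intro _ h; exact absurd h (lt_irrefl _)
    | succ k ih =>
      intro hk _ ht
      by_cases h : G.τ k ≤ t
      · exact ⟨k, by omega, h, ht⟩
      · push Not at h
        have hk0 : 0 < k := by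
          rcases Nat.eq_zero_or_pos k with h0 | h0
          · rw [h0, G.τ_zero] at h
            exact absurd t.2.1 (not_le.2 h)
          · exact h0
        obtain ⟨n, hn, hmem⟩ := ih (by omega) hk0 h.le
        exact ⟨n, by omega, hmem⟩
  exact key G.N le_rfl (G.N_pos hT) (t.2.2.trans_eq G.τ_last.symm)

variable {G} {k n : ℕ} {t : Icc (0 : ℝ) T}

theorem gridMap_of_lt (hk : k < G.N) (ht : (t : ℝ) ∈ Icc (G.τ k) (G.τ (k + 1))) (hn : n < k) :
    gridMap G n t = 1 := by
  refine projIcc_of_right_le zero_le_one ?_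
  have h0 := G.τ_lt n (by omega)
  rw [one_le_div (by linarith)]
  have := G.τ_le_of_le (show n + 1 ≤ k from hn) hk.le
  linarith [ht.1]

theorem gridMap_of_gt (ht : (t : ℝ) ∈ Icc (G.τ k) (G.τ (k + 1))) (hn : n < G.N) (hkn : k < n) :
    gridMap G n t = 0 := by
  refine projIcc_of_le_left zero_le_one ?_
  have h0 := G.τ_lt n hn
  have := G.τ_le_of_le (show k + 1 ≤ n from hkn) hn.le
  exact div_nonpos_of_nonpos_of_nonneg (by linarith [ht.2]) (by linarith)

theorem gridMap_coe (hk : k < G.N) (ht : (t : ℝ) ∈ Icc (G.τ k) (G.τ (k + 1))) :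
    (gridMap G k t : ℝ) = ((t : ℝ) - G.τ k) / (G.τ (k + 1) - G.τ k) := by
  have h0 := G.τ_lt k hk
  have hm : ((t : ℝ) - G.τ k) / (G.τ (k + 1) - G.τ k) ∈ Icc (0 : ℝ) 1 :=
    ⟨div_nonneg (by linarith [ht.1]) (by linarith), (div_le_one (by linarith)).2
      (by linarith [ht.2])⟩
  show ((projIcc 0 1 zero_le_one _ : unitInterval) : ℝ) = _
  rw [projIcc_of_mem zero_le_one hm]

theorem sum_comp_gridMap_apply (hk : k < G.N) (ht : (t : ℝ) ∈ Icc (G.τ k) (G.τ (k + 1)))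
    (g : ℕ → C(unitInterval, ℝ)) (h0 : ∀ n, g n 0 = 0) (h1 : ∀ n, g n 1 = 0) :
    ∑ n ∈ Finset.range G.N, g n (gridMap G n t) = g k (gridMap G k t) := by
  refine Finset.sum_eq_single_of_mem k (Finset.mem_range.2 hk) fun n hn hne => ?_
  rcases lt_or_gt_of_ne hne with h | h
  · rw [gridMap_of_lt hk ht h, h1]
  · rw [gridMap_of_gt ht (Finset.mem_range.1 hn) h, h0]

/-- A function vanishing at `0` and `1`, composed with `gridMap G n`, is zero off the `n`-th
interval. The supports overlap only at grid points, so the sup norm of the sum is a maximum. -/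
theorem norm_sum_comp_gridMap_le (hT : 0 < T) (g : ℕ → C(unitInterval, ℝ)) (h0 : ∀ n, g n 0 = 0)
    (h1 : ∀ n, g n 1 = 0) {R : ℝ} (hR0 : 0 ≤ R) (hR : ∀ n < G.N, ‖g n‖ ≤ R) :
    ‖∑ n ∈ Finset.range G.N, (g n).comp (gridMap G n)‖ ≤ R := by
  rw [ContinuousMap.norm_le _ hR0]
  intro t
  obtain ⟨k, hk, ht⟩ := G.exists_mem hT t
  rw [ContinuousMap.sum_apply]
  simp only [ContinuousMap.comp_apply]
  rw [sum_comp_gridMap_apply hk ht g h0 h1]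
  exact ((g k).norm_coe_le_norm _).trans (hR k hk)

end GridMap

/-! ### Both interpolations as explicit functions of the increments and the bridges. -/

section Paths

variable {T : ℝ} (b σ : ℝ → ℝ) (ξ₀ : ℝ) (G : TimeGrid T)

/-- The Euler recursion with step sizes given by `G`, driven by the increments `d`. -/
def nodeOfIncr (d : ℕ → ℝ) : ℕ → ℝ
  | 0 => ξ₀
  | n + 1 => nodeOfIncr d n + b (nodeOfIncr d n) * (G.τ (n + 1) - G.τ n) + σ (nodeOfIncr d n) * d n

/-- The piecewise linear path through the values of the Euler recursion driven by `d`. -/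
def linearOfIncr (d : ℕ → ℝ) : C(Icc (0 : ℝ) T, ℝ) :=
  ContinuousMap.const _ ξ₀ + ∑ n ∈ Finset.range G.N,
    (nodeOfIncr b σ ξ₀ G d (n + 1) - nodeOfIncr b σ ξ₀ G d n) •
      (⟨fun x => (x : ℝ), continuous_subtype_val⟩ : C(unitInterval, ℝ)).comp (gridMap G n)

variable {b σ ξ₀ G}

theorem eulerNode_eq_nodeOfIncr {w : ℝ≥0 → ℝ} {d : ℕ → ℝ}
    (hd : ∀ n < G.N, d n = w (G.τ (n + 1)).toNNReal - w (G.τ n).toNNReal) :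
    ∀ n ≤ G.N, eulerNode b σ ξ₀ G w n = nodeOfIncr b σ ξ₀ G d n := by
  intro n
  induction n with
  | zero => intro _; rfl
  | succ k ih => intro hk; rw [eulerNode, nodeOfIncr, ih (by omega), hd k (by omega)]

theorem linearOfIncr_apply (d : ℕ → ℝ) {k : ℕ} {t : Icc (0 : ℝ) T} (hk : k < G.N)
    (ht : (t : ℝ) ∈ Icc (G.τ k) (G.τ (k + 1))) :
    linearOfIncr b σ ξ₀ G d t = nodeOfIncr b σ ξ₀ G d k + ((t : ℝ) - G.τ k) /
      (G.τ (k + 1) - G.τ k) *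
      (nodeOfIncr b σ ξ₀ G d (k + 1) - nodeOfIncr b σ ξ₀ G d k) := by
  have h1 : linearOfIncr b σ ξ₀ G d t = ξ₀ + ∑ n ∈ Finset.range G.N,
      (nodeOfIncr b σ ξ₀ G d (n + 1) - nodeOfIncr b σ ξ₀ G d n) * (gridMap G n t : ℝ) := by
    simp [linearOfIncr, ContinuousMap.sum_apply]
  -- Ramps of earlier intervals have reached `1` and telescope to the node `k`; ramps of later
  -- intervals are still `0`.
  rw [h1, ← Finset.sum_range_add_sum_Ico _ hk.le, Finset.sum_eq_sum_Ico_succ_bot hk,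
    gridMap_coe hk ht]
  have h2 : ∑ n ∈ Finset.range k,
      (nodeOfIncr b σ ξ₀ G d (n + 1) - nodeOfIncr b σ ξ₀ G d n) * (gridMap G n t : ℝ)
      = nodeOfIncr b σ ξ₀ G d k - ξ₀ := by
    have h3 := Finset.sum_range_sub (nodeOfIncr b σ ξ₀ G d) k
    rw [show nodeOfIncr b σ ξ₀ G d 0 = ξ₀ from rfl] at h3
    rw [← h3]
    refine Finset.sum_congr rfl fun n hn => ?_
    rw [gridMap_of_lt hk ht (Finset.mem_range.1 hn)]
    simp
  have h4 : ∑ n ∈ Finset.Ico (k + 1) G.N,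
      (nodeOfIncr b σ ξ₀ G d (n + 1) - nodeOfIncr b σ ξ₀ G d n) * (gridMap G n t : ℝ) = 0 := by
    refine Finset.sum_eq_zero fun n hn => ?_
    rw [Finset.mem_Ico] at hn
    rw [gridMap_of_gt ht hn.2 (by omega)]
    simp
  rw [h2, h4]
  ring

theorem toPath_apply {g : ℝ → ℝ} (hg : ContinuousOn g (Icc 0 T)) (t : Icc (0 : ℝ) T) :
    toPath T g t = g t := by
  rw [toPath, dif_pos hg]
  rfl

theorem toPath_linearInterp (hT : 0 < T) {w : ℝ≥0 → ℝ} {d : ℕ → ℝ}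
    (hd : ∀ n < G.N, d n = w (G.τ (n + 1)).toNNReal - w (G.τ n).toNNReal) :
    toPath T (linearInterp b σ ξ₀ G w) = linearOfIncr b σ ξ₀ G d := by
  ext t
  obtain ⟨k, hk, ht⟩ := G.exists_mem hT t
  rw [toPath_apply (continuousOn_linearInterp b σ ξ₀ G w), linearInterp_eq b σ ξ₀ G w hk ht,
    linearOfIncr_apply d hk ht, linearPiece, eulerNode_eq_nodeOfIncr hd _ hk.le,
    eulerNode_eq_nodeOfIncr hd _ hk]

/-- The drift integral is linear in time, hence already contained in the linear path; only the
diffusion coefficient times the bridge remains. -/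
theorem toPath_stochasticInterp (hT : 0 < T) {w : ℝ≥0 → ℝ} (hw : Continuous w) {d : ℕ → ℝ}
    (hd : ∀ n < G.N, d n = w (G.τ (n + 1)).toNNReal - w (G.τ n).toNNReal)
    {β : ℕ → C(unitInterval, ℝ)} (hβ : ∀ n < G.N, ∀ u : unitInterval,
      β n u = w (G.τ n + u * (G.τ (n + 1) - G.τ n)).toNNReal - w (G.τ n).toNNReal - u * d n)
    (h0 : ∀ n, β n 0 = 0) (h1 : ∀ n, β n 1 = 0) :
    toPath T (stochasticInterp b σ ξ₀ G w) = linearOfIncr b σ ξ₀ G d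
      + ∑ n ∈ Finset.range G.N, (σ (nodeOfIncr b σ ξ₀ G d n) • β n).comp (gridMap G n) := by
  ext t
  obtain ⟨k, hk, ht⟩ := G.exists_mem hT t
  rw [toPath_apply (continuousOn_stochasticInterp b σ ξ₀ G w hw),
    stochasticInterp_eq b σ ξ₀ G w hk ht, ContinuousMap.add_apply, linearOfIncr_apply d hk ht,
    ContinuousMap.sum_apply]
  simp only [ContinuousMap.comp_apply]
  rw [sum_comp_gridMap_apply hk ht (fun n => σ (nodeOfIncr b σ ξ₀ G d n) • β n)
    (by simp [h0]) (by simp [h1]), ContinuousMap.smul_apply, hβ k hk, gridMap_coe hk ht,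
    stochasticPiece, elementaryIntegral, eulerNode_eq_nodeOfIncr hd _ hk.le, nodeOfIncr]
  have h2 : G.τ (k + 1) - G.τ k ≠ 0 := (sub_pos.2 (G.τ_lt k hk)).ne'
  rw [div_mul_cancel₀ _ h2]
  simp only [intervalIntegral.integral_const, smul_eq_mul, add_sub_cancel]
  field_simp
  ring

theorem continuous_nodeOfIncr (hb : Continuous b) (hσ : Continuous σ) (n : ℕ) :
    Continuous fun d => nodeOfIncr b σ ξ₀ G d n := by
  induction n with
  | zero => exact continuous_const
  | succ k ih => simp only [nodeOfIncr]; fun_prop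

theorem continuous_linearOfIncr (hb : Continuous b) (hσ : Continuous σ) :
    Continuous fun d => linearOfIncr b σ ξ₀ G d := by
  have := continuous_nodeOfIncr (ξ₀ := ξ₀) (G := G) hb hσ
  unfold linearOfIncr
  fun_prop

theorem norm_linearOfIncr_le (hT : 0 < T) {d : ℕ → ℝ} {R : ℝ}
    (hR : ∀ n ≤ G.N, |nodeOfIncr b σ ξ₀ G d n| ≤ R) : ‖linearOfIncr b σ ξ₀ G d‖ ≤ R := by
  rw [ContinuousMap.norm_le _ ((abs_nonneg _).trans (hR 0 (Nat.zero_le _)))]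
  intro t
  obtain ⟨k, hk, ht⟩ := G.exists_mem hT t
  have hmem := (gridMap G k t).2
  rw [gridMap_coe hk ht] at hmem
  rw [linearOfIncr_apply d hk ht, Real.norm_eq_abs]
  have h1 := hR k hk.le
  have h2 := hR (k + 1) hk
  set c := ((t : ℝ) - G.τ k) / (G.τ (k + 1) - G.τ k)
  rw [abs_le] at *
  constructor <;> nlinarith [hmem.1, hmem.2]

theorem abs_nodeOfIncr_le (hT : 0 < T) (d : ℕ → ℝ) {n : ℕ} (hn : n ≤ G.N) :
    |nodeOfIncr b σ ξ₀ G d n| ≤ ‖linearOfIncr b σ ξ₀ G d‖ := by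
  rcases Nat.lt_or_ge n G.N with h | h
  · have h1 := (linearOfIncr b σ ξ₀ G d).norm_coe_le_norm ⟨G.τ n, G.τ_nonneg hn, G.τ_le hn⟩
    rw [linearOfIncr_apply d h ⟨le_rfl, (G.τ_lt n h).le⟩] at h1
    simpa using h1
  · obtain ⟨m, rfl⟩ : ∃ m, n = m + 1 := ⟨n - 1, by have := G.N_pos hT; omega⟩
    have h1 := (linearOfIncr b σ ξ₀ G d).norm_coe_le_norm
      ⟨G.τ (m + 1), G.τ_nonneg hn, G.τ_le hn⟩
    have h2 := G.τ_lt m (by omega)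
    rw [linearOfIncr_apply d (by omega : m < G.N) ⟨h2.le, le_rfl⟩,
      div_self (sub_pos.2 h2).ne'] at h1
    simpa using h1

end Paths

/-! ### One-step Lyapunov estimate for the Euler scheme. -/

/-- The linear term is kept exactly, because it contains the part of order `√Δ` that vanishes on
averaging over the noise. -/
theorem one_add_pow_le {x : ℝ} (hx : 0 ≤ 1 + x) (m : ℕ) :
    (1 + x) ^ m ≤ 1 + m * x + m ^ 2 * x ^ 2 * (1 + |x|) ^ m := by
  induction m with
  | zero => simp
  | succ k ih =>
    have h1 : (1 + x) ^ (k + 1) ≤ (1 + k * x + k ^ 2 * x ^ 2 * (1 + |x|) ^ k) * (1 + x) := by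
      rw [pow_succ]; gcongr
    have h2 : (1 + x) ≤ 1 + |x| := by linarith [le_abs_self x]
    have h3 : (1 : ℝ) ≤ (1 + |x|) ^ (k + 1) := one_le_pow₀ (by linarith [abs_nonneg x])
    have h4 : (k : ℝ) ^ 2 * x ^ 2 * (1 + |x|) ^ k * (1 + x)
        ≤ k ^ 2 * x ^ 2 * (1 + |x|) ^ (k + 1) := by
      rw [pow_succ (1 + |x|) k, ← mul_assoc]; gcongr
    have h5 : (k : ℝ) * x ^ 2 * 1 ≤ k * x ^ 2 * (1 + |x|) ^ (k + 1) := by gcongr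
    have h6 : 0 ≤ ((k : ℝ) + 1) * x ^ 2 * (1 + |x|) ^ (k + 1) := by positivity
    push_cast
    nlinarith

/-- A function of the size of the noise that controls the second order part of an Euler step. -/
def stepRemainder (L : ℝ) (m : ℕ) (ξ : ℝ) : ℝ :=
  m * (2 * L + L ^ 2 * (1 + |ξ|) ^ 2)
    + m ^ 2 * (9 * L ^ 4 * (1 + |ξ|) ^ 4) * (1 + 3 * L ^ 2 * (1 + |ξ|) ^ 2) ^ m

/-- Here `h` is the square root of the step size, and `r`, `p`, `s` are the position, the drift and
the diffusion divided by `√(1 + y²)`. Apart from a term linear in `ξ`, everything is of order `h²`,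
that is, of the order of the step size. -/
theorem one_add_pow_step_le {L r p s h ξ : ℝ} (m : ℕ) (hL : 1 ≤ L) (hr : |r| ≤ 1) (hp : |p| ≤ L)
    (hs : |s| ≤ L) (h0 : 0 ≤ h) (h1 : h ≤ 1)
    (hx : 0 ≤ 1 + (2 * r * (p * h ^ 2 + s * h * ξ) + (p * h ^ 2 + s * h * ξ) ^ 2)) :
    (1 + (2 * r * (p * h ^ 2 + s * h * ξ) + (p * h ^ 2 + s * h * ξ) ^ 2)) ^ m
      ≤ 1 + 2 * m * r * s * h * ξ + h ^ 2 * stepRemainder L m ξ := by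
  set R := 2 * r * (p * h ^ 2 + s * h * ξ) + (p * h ^ 2 + s * h * ξ) ^ 2 with hR
  set a := 1 + |ξ| with ha
  have ha1 : 1 ≤ a := by linarith [abs_nonneg ξ]
  have hinc : |p * h + s * ξ| ≤ L * a := by
    calc |p * h + s * ξ| ≤ |p| * |h| + |s| * |ξ| := by
          rw [← abs_mul, ← abs_mul]; exact abs_add_le _ _
      _ ≤ L * 1 + L * |ξ| := by rw [abs_of_nonneg h0]; gcongr
      _ = L * a := by rw [ha]; ring
  have hLa : 0 ≤ L * a := by positivity
  have hR1 : R = 2 * r * s * h * ξ + h ^ 2 * (2 * r * p + (p * h + s * ξ) ^ 2) := by rw [hR]; ring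
  have hrp : r * p ≤ L := by
    calc r * p ≤ |r * p| := le_abs_self _
      _ = |r| * |p| := abs_mul _ _
      _ ≤ 1 * L := by gcongr
      _ = L := one_mul _
  have hsq : (p * h + s * ξ) ^ 2 ≤ L ^ 2 * a ^ 2 := by
    rw [← mul_pow, ← sq_abs]; gcongr
  have hRle : R ≤ 2 * r * s * h * ξ + h ^ 2 * (2 * L + L ^ 2 * a ^ 2) := by
    rw [hR1];
    have : 2 * r * p + (p * h + s * ξ) ^ 2 ≤ 2 * L + L ^ 2 * a ^ 2 := by linarith
    gcongr
  have hRabs : |R| ≤ h * (3 * L ^ 2 * a ^ 2) := by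
    have e : R = h * (2 * r * (p * h + s * ξ) + h * (p * h + s * ξ) ^ 2) := by rw [hR]; ring
    rw [e, abs_mul, abs_of_nonneg h0]
    gcongr
    calc |2 * r * (p * h + s * ξ) + h * (p * h + s * ξ) ^ 2|
        ≤ |2 * r * (p * h + s * ξ)| + |h * (p * h + s * ξ) ^ 2| := abs_add_le _ _
      _ = 2 * |r| * |p * h + s * ξ| + h * (p * h + s * ξ) ^ 2 := by
          rw [abs_mul, abs_mul, abs_mul, abs_of_nonneg h0, abs_of_nonneg (sq_nonneg
            (p * h + s * ξ))]
          norm_num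
      _ ≤ 2 * 1 * (L * a) + 1 * (L ^ 2 * a ^ 2) := by gcongr
      _ ≤ 3 * L ^ 2 * a ^ 2 := by
          have : 1 ≤ L * a := one_le_mul_of_one_le_of_one_le hL ha1
          nlinarith
  have hR2 : R ^ 2 ≤ h ^ 2 * (9 * L ^ 4 * a ^ 4) := by
    have := pow_le_pow_left₀ (abs_nonneg R) hRabs 2
    rw [sq_abs] at this
    exact this.trans_eq (by ring)
  have hRa : |R| ≤ 3 * L ^ 2 * a ^ 2 :=
    hRabs.trans (mul_le_of_le_one_left (by positivity) h1)
  calc (1 + R) ^ m ≤ 1 + m * R + m ^ 2 * R ^ 2 * (1 + |R|) ^ m := one_add_pow_le hx m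
    _ ≤ 1 + m * (2 * r * s * h * ξ + h ^ 2 * (2 * L + L ^ 2 * a ^ 2))
        + m ^ 2 * (h ^ 2 * (9 * L ^ 4 * a ^ 4)) * (1 + 3 * L ^ 2 * a ^ 2) ^ m := by gcongr
    _ = _ := by rw [stepRemainder]; ring

theorem stepRemainder_nonneg {L : ℝ} (hL : 0 ≤ L) (m : ℕ) (ξ : ℝ) : 0 ≤ stepRemainder L m ξ := by
  unfold stepRemainder; positivity

theorem continuous_stepRemainder (L : ℝ) (m : ℕ) : Continuous (stepRemainder L m) := by
  unfold stepRemainder; fun_prop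

theorem stepRemainder_le {L : ℝ} (hL : 1 ≤ L) (m : ℕ) (ξ : ℝ) :
    stepRemainder L m ξ ≤ (3 * m * L ^ 2 + 9 * m ^ 2 * L ^ 4 * (4 * L ^ 2) ^ m) *
      (1 + 0 + ‖ξ‖) ^ (4 + 2 * m) := by
  rw [stepRemainder, Real.norm_eq_abs, add_zero]
  set a := 1 + |ξ| with ha
  have ha1 : 1 ≤ a := by linarith [abs_nonneg ξ]
  have e1 : 2 * L + L ^ 2 * a ^ 2 ≤ 3 * L ^ 2 * a ^ (4 + 2 * m) := by
    have h1 : a ^ 2 ≤ a ^ (4 + 2 * m) := pow_le_pow_right₀ ha1 (by omega)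
    have h2 : 1 ≤ a ^ (4 + 2 * m) := one_le_pow₀ ha1
    have h3 : L ≤ L ^ 2 := by nlinarith
    nlinarith [mul_le_mul_of_nonneg_left h1 (sq_nonneg L), mul_le_mul h3 h2 zero_le_one
      (sq_nonneg L)]
  have e2 : (1 + 3 * L ^ 2 * a ^ 2) ^ m ≤ (4 * L ^ 2) ^ m * a ^ (2 * m) := by
    rw [pow_mul, ← mul_pow]
    gcongr
    have : 1 ≤ L ^ 2 * a ^ 2 := one_le_mul_of_one_le_of_one_le (one_le_pow₀ hL) (one_le_pow₀ ha1)
    linarith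
  calc _ ≤ m * (3 * L ^ 2 * a ^ (4 + 2 * m))
        + m ^ 2 * (9 * L ^ 4 * a ^ 4) * ((4 * L ^ 2) ^ m * a ^ (2 * m)) := by gcongr
    _ = _ := by rw [pow_add]; ring

theorem integrable_stepRemainder {L : ℝ} (hL : 1 ≤ L) (m : ℕ) :
    Integrable (stepRemainder L m) (gaussianReal 0 1) := by
  refine ((integrable_one_add_norm_pow (E := ℝ) (κ := gaussianReal 0 1) 0 le_rfl
    (4 + 2 * m)).const_mul
    (3 * m * L ^ 2 + 9 * m ^ 2 * L ^ 4 * (4 * L ^ 2) ^ m)).mono'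
    (continuous_stepRemainder L m).aestronglyMeasurable (ae_of_all _ fun ξ => ?_)
  rw [Real.norm_of_nonneg (stepRemainder_nonneg (by linarith) m ξ)]
  exact stepRemainder_le hL m ξ

theorem lintegral_step_le {L : ℝ} (hL : 1 ≤ L) (m : ℕ) {y β η : ℝ} (hβ : β ^ 2 ≤ L ^ 2 *
    (1 + y ^ 2))
    (hη : η ^ 2 ≤ L ^ 2 * (1 + y ^ 2)) {Δ : ℝ≥0} (hΔ : Δ ≤ 1) :
    ∫⁻ x, ENNReal.ofReal ((1 + (y + β * Δ + η * x) ^ 2) ^ m) ∂(gaussianReal 0 Δ)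
      ≤ ENNReal.ofReal (1 + (∫ ξ, stepRemainder L m ξ ∂(gaussianReal 0 1)) * Δ)
        * ENNReal.ofReal ((1 + y ^ 2) ^ m) := by
  set q := √(1 + y ^ 2) with hq
  have hq2 : q ^ 2 = 1 + y ^ 2 := Real.sq_sqrt (by positivity)
  have hq0 : 0 < q := Real.sqrt_pos.2 (by positivity)
  set h := √(Δ : ℝ) with hh
  have hh2 : h ^ 2 = Δ := Real.sq_sqrt Δ.2
  have hh0 : 0 ≤ h := Real.sqrt_nonneg _
  have hh1 : h ≤ 1 := Real.sqrt_le_one.2 (by exact_mod_cast hΔ)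
  have hmap : gaussianReal 0 Δ = (gaussianReal 0 1).map (fun ξ => h * ξ) := by
    rw [gaussianReal_map_const_mul]
    congr 1
    · simp
    · ext; simp [hh2]
  rw [hmap, lintegral_map (by fun_prop) (by fun_prop)]
  have hr : |y / q| ≤ 1 := by
    rw [abs_div, abs_of_pos hq0, div_le_one hq0]
    exact abs_le_of_sq_le_sq (by rw [hq2]; linarith) hq0.le
  have hdiv : ∀ z : ℝ, z ^ 2 ≤ L ^ 2 * (1 + y ^ 2) → |z / q| ≤ L := by
    intro z hz
    rw [abs_div, abs_of_pos hq0, div_le_iff₀ hq0]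
    refine abs_le_of_sq_le_sq ?_ (by positivity)
    rw [mul_pow, hq2]; exact hz
  have hpt : ∀ ξ, (1 + (y + β * Δ + η * (h * ξ)) ^ 2) ^ m ≤
      (1 + y ^ 2) ^ m * (1 + (2 * m * (y / q) * (η / q) * h) * ξ + Δ * stepRemainder L m ξ) := by
    intro ξ
    have e : 1 + (y + β * Δ + η * (h * ξ)) ^ 2 = q ^ 2 * (1 + (2 * (y / q) *
      (β / q * h ^ 2 + η / q * h * ξ)
        + (β / q * h ^ 2 + η / q * h * ξ) ^ 2)) := by
      rw [hh2]; field_simp; rw [hq2]; ring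
    have hx : 0 ≤ 1 + (2 * (y / q) * (β / q * h ^ 2 + η / q * h * ξ)
        + (β / q * h ^ 2 + η / q * h * ξ) ^ 2) := by
      refine nonneg_of_mul_nonneg_right (a := q ^ 2) ?_ (by positivity)
      rw [← e]; positivity
    have hst := one_add_pow_step_le m hL hr (hdiv β hβ) (hdiv η hη) hh0 hh1 hx
    rw [e, mul_pow, hq2]
    rw [← hh2]
    exact mul_le_mul_of_nonneg_left hst (by positivity)
  have hΦ := integrable_stepRemainder hL m
  have hid : Integrable (fun ξ : ℝ => ξ) (gaussianReal 0 1) := IsGaussian.integrable_id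
  have hint : Integrable (fun ξ => (1 + y ^ 2) ^ m *
      (1 + (2 * m * (y / q) * (η / q) * h) * ξ + Δ * stepRemainder L m ξ)) (gaussianReal 0 1) :=
    (((integrable_const 1).add (hid.const_mul _)).add (hΦ.const_mul _)).const_mul _
  calc _ ≤ ∫⁻ ξ, ENNReal.ofReal ((1 + y ^ 2) ^ m *
      (1 + (2 * m * (y / q) * (η / q) * h) * ξ + Δ * stepRemainder L m ξ)) ∂(gaussianReal 0 1) :=
        lintegral_mono fun ξ => ENNReal.ofReal_le_ofReal (hpt ξ)
    _ = ENNReal.ofReal (∫ ξ, (1 + y ^ 2) ^ m *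
      (1 + (2 * m * (y / q) * (η / q) * h) * ξ + Δ * stepRemainder L m ξ) ∂(gaussianReal 0 1)) := by
        rw [ofReal_integral_eq_lintegral_ofReal hint]
        exact ae_of_all _ fun ξ => le_trans (by positivity) (hpt ξ)
    _ = _ := by
        -- The Gaussian has mean zero, so the term linear in `ξ`, of order `√Δ`, disappears.
        rw [integral_const_mul, integral_add (by exact (integrable_const _).add (hid.const_mul _))
          (hΦ.const_mul _),
          integral_add (integrable_const _) (hid.const_mul _), integral_const_mul,
            integral_const_mul,
          integral_id_gaussianReal, mul_comm, ENNReal.ofReal_mul' (by positivity)]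
        simp [mul_comm]

/-- Layer cake formula: the tail is at most `1` up to level `1`, and `K r⁻²` has integral `K` beyond
it. -/
theorem lintegral_ofReal_le_of_meas_le {Ω : Type*} [MeasurableSpace Ω] {P : Measure Ω}
    [IsProbabilityMeasure P] {f : Ω → ℝ} (hf0 : ∀ ω, 0 ≤ f ω) (hf : AEMeasurable f P) {K : ℝ}
    (hK : 0 ≤ K) (h : ∀ r : ℝ, 1 ≤ r → P {ω | r ≤ f ω} ≤ ENNReal.ofReal (K * r ^ (-2 : ℝ))) :
    ∫⁻ ω, ENNReal.ofReal (f ω) ∂P ≤ ENNReal.ofReal (1 + K) := by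
  rw [lintegral_eq_lintegral_meas_le P (ae_of_all _ hf0) hf,
    ← Ioc_union_Ioi_eq_Ioi (zero_le_one (α := ℝ)),
    lintegral_union measurableSet_Ioi (Ioc_disjoint_Ioi le_rfl), ENNReal.ofReal_add zero_le_one hK]
  gcongr
  · calc ∫⁻ t in Ioc (0 : ℝ) 1, P {a | t ≤ f a} ≤ ∫⁻ _t in Ioc (0 : ℝ) 1, 1 :=
          lintegral_mono fun _ => prob_le_one
      _ = ENNReal.ofReal 1 := by simp
  · have hi : IntegrableOn (fun t : ℝ => K * t ^ (-2 : ℝ)) (Ioi 1) :=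
      (integrableOn_Ioi_rpow_of_lt (by norm_num) zero_lt_one).const_mul K
    calc ∫⁻ t in Ioi (1 : ℝ), P {a | t ≤ f a} ≤ ∫⁻ t in Ioi (1 : ℝ), ENNReal.ofReal (
      K * t ^ (-2 : ℝ)) :=
          setLIntegral_mono' measurableSet_Ioi fun t ht => h t (le_of_lt ht)
      _ = ENNReal.ofReal (∫ t in Ioi (1 : ℝ), K * t ^ (-2 : ℝ)) := by
          rw [ofReal_integral_eq_lintegral_ofReal hi]
          refine (ae_restrict_iff' measurableSet_Ioi).2 (ae_of_all _ fun t ht => ?_)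
          have : (0 : ℝ) < t := zero_lt_one.trans ht
          positivity
      _ = ENNReal.ofReal K := by
          rw [integral_const_mul, integral_Ioi_rpow_of_lt (by norm_num) zero_lt_one]
          norm_num

/-! ### Moments of the maximum of the Euler scheme by stopping. -/

section StoppedChain

variable {T : ℝ} (b σ : ℝ → ℝ) (ξ₀ : ℝ) (G : TimeGrid T) (m : ℕ) (r : ℝ)

/-- The Euler recursion, stopped when `(1 + y²) ^ m` reaches the level `r`. -/
def stoppedNode (d : ℕ → ℝ) : ℕ → ℝ
  | 0 => ξ₀
  | n + 1 => if r ≤ (1 + stoppedNode d n ^ 2) ^ m then stoppedNode d n else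
      stoppedNode d n + b (stoppedNode d n) * (G.τ (n + 1) - G.τ n) + σ (stoppedNode d n) * d n

variable {b σ ξ₀ G m r}

theorem stoppedNode_congr {d d' : ℕ → ℝ} {n : ℕ} (h : ∀ k < n, d k = d' k) :
    stoppedNode b σ ξ₀ G m r d n = stoppedNode b σ ξ₀ G m r d' n := by
  induction n with
  | zero => rfl
  | succ k ih =>
    rw [stoppedNode, stoppedNode, ih fun j hj => h j (by omega), h k (by omega)]

theorem measurable_stoppedNode (hb : Continuous b) (hσ : Continuous σ) (n : ℕ) :
    Measurable fun d => stoppedNode b σ ξ₀ G m r d n := by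
  induction n with
  | zero => exact measurable_const
  | succ k ih =>
    simp only [stoppedNode]
    refine Measurable.ite (measurableSet_le measurable_const (by fun_prop)) ih ?_
    have hb' := hb.measurable
    have hσ' := hσ.measurable
    fun_prop

/-- The stopped chain freezes above the level, so its value at one later time records whether the
maximum has reached it. A maximal inequality thus reduces to Markov's inequality at a single time.
-/
theorem le_stoppedNode_of_exists (d : ℕ → ℝ) (n : ℕ)
    (h : ∃ k ≤ n, r ≤ (1 + nodeOfIncr b σ ξ₀ G d k ^ 2) ^ m) :
    r ≤ (1 + stoppedNode b σ ξ₀ G m r d n ^ 2) ^ m := by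
  have key : ∀ n, r ≤ (1 + stoppedNode b σ ξ₀ G m r d n ^ 2) ^ m ∨
      (stoppedNode b σ ξ₀ G m r d n = nodeOfIncr b σ ξ₀ G d n ∧
        ∀ k ≤ n, (1 + nodeOfIncr b σ ξ₀ G d k ^ 2) ^ m < r) := by
    intro n
    induction n with
    | zero =>
      rcases le_or_gt r ((1 + ξ₀ ^ 2) ^ m) with h | h
      · exact Or.inl h
      · refine Or.inr ⟨rfl, fun k hk => ?_⟩
        rw [Nat.le_zero.1 hk]
        exact h
    | succ n ih =>
      rcases ih with ih | ⟨ih, ih'⟩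
      · left
        rwa [stoppedNode, if_pos ih]
      · have e : stoppedNode b σ ξ₀ G m r d (n + 1) = nodeOfIncr b σ ξ₀ G d (n + 1) := by
          rw [stoppedNode, ih, if_neg (not_le.2 (ih' n le_rfl)), nodeOfIncr]
        rw [e]
        rcases le_or_gt r ((1 + nodeOfIncr b σ ξ₀ G d (n + 1) ^ 2) ^ m) with h | h
        · exact Or.inl h
        · refine Or.inr ⟨rfl, fun k hk => ?_⟩
          rcases hk.eq_or_lt with rfl | hk'
          · exact h
          · exact ih' k (by omega)
  rcases key n with h1 | ⟨_, h2⟩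
  · exact h1
  · obtain ⟨k, hk, hk'⟩ := h
    exact absurd hk' (not_le.2 (h2 k hk))

variable {Ω : Type*} [MeasurableSpace Ω] {P : Measure Ω} {θ : ℕ → Ω → ℝ}

/-- The `n`-th value depends only on the increments of index less than `n`. -/
theorem indepFun_stoppedNode (hb : Continuous b) (hσ : Continuous σ) (hθ : iIndepFun θ P)
    (hm : ∀ n, AEMeasurable (θ n) P) (n : ℕ) :
    IndepFun (fun ω => stoppedNode b σ ξ₀ G m r (fun k => θ k ω) n) (θ n) P := by
  classical
  have h := hθ.indepFun_finset₀ (Finset.range n) {n} (by simp) hm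
  let ext : (Finset.range n → ℝ) → ℕ → ℝ := fun x k => if h : k ∈ Finset.range n then x
    ⟨k, h⟩ else 0
  have hext : Measurable ext := by
    refine measurable_pi_lambda _ fun k => ?_
    by_cases hk : k ∈ Finset.range n
    · simp only [ext, dif_pos hk]; fun_prop
    · simp only [ext, dif_neg hk]; fun_prop
  have hψ : Measurable fun x : ({n} : Finset ℕ) → ℝ => x ⟨n, Finset.mem_singleton_self n⟩ :=
    measurable_pi_apply _
  have h2 := h.comp (φ := fun x => stoppedNode b σ ξ₀ G m r (ext x) n)
    ((measurable_stoppedNode hb hσ n).comp hext) hψ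
  convert h2 using 1
  · ext ω
    refine stoppedNode_congr fun k hk => ?_
    simp [ext, hk]
  · rfl

variable [IsProbabilityMeasure P]

theorem lintegral_stoppedNode_succ_le {L : ℝ} (hL : 1 ≤ L) (hb : Continuous b) (hσ : Continuous σ)
    (hbL : ∀ y, b y ^ 2 ≤ L ^ 2 * (1 + y ^ 2)) (hσL : ∀ y, σ y ^ 2 ≤ L ^ 2 * (1 + y ^ 2))
    (hθ : iIndepFun θ P) (hm : ∀ n, AEMeasurable (θ n) P) (hG : G.mesh ≤ 1) {n : ℕ} (hn : n < G.N)
    (hlaw : P.map (θ n) = gaussianReal 0 (G.τ (n + 1) - G.τ n).toNNReal) :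
    ∫⁻ ω, ENNReal.ofReal ((1 + stoppedNode b σ ξ₀ G m r (fun k => θ k ω) (n + 1) ^ 2) ^ m) ∂P
      ≤ ENNReal.ofReal (1 + (∫ ξ, stepRemainder L m ξ ∂(gaussianReal 0 1)) *
        (G.τ (n + 1) - G.τ n)) *
        ∫⁻ ω, ENNReal.ofReal ((1 + stoppedNode b σ ξ₀ G m r (fun k => θ k ω) n ^ 2) ^ m) ∂P := by
  set C := ∫ ξ, stepRemainder L m ξ ∂(gaussianReal 0 1)
  have hC : 0 ≤ C := integral_nonneg fun ξ => stepRemainder_nonneg (by linarith) m ξ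
  have hΔ0 : 0 < G.τ (n + 1) - G.τ n := sub_pos.2 (G.τ_lt n hn)
  set Δ : ℝ≥0 := (G.τ (n + 1) - G.τ n).toNNReal with hΔ
  have hΔc : (Δ : ℝ) = G.τ (n + 1) - G.τ n := Real.coe_toNNReal _ hΔ0.le
  have hΔ1 : Δ ≤ 1 := by
    rw [← NNReal.coe_le_coe, hΔc]
    exact (G.sub_le_mesh hn).trans hG
  rw [← hΔc]
  set z : Ω → ℝ := fun ω => stoppedNode b σ ξ₀ G m r (fun k => θ k ω) n with hz
  have hzm : AEMeasurable z P :=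
    (measurable_stoppedNode hb hσ n).comp_aemeasurable (aemeasurable_pi_lambda _ hm)
  have hb' := hb.measurable
  have hσ' := hσ.measurable
  let F : ℝ × ℝ → ℝ≥0∞ := fun p => if r ≤ (1 + p.1 ^ 2) ^ m then ENNReal.ofReal ((1 + p.1 ^ 2) ^ m)
    else ENNReal.ofReal ((1 + (p.1 + b p.1 * Δ + σ p.1 * p.2) ^ 2) ^ m)
  have hF : Measurable F := by
    refine Measurable.ite (measurableSet_le measurable_const (by fun_prop)) ?_ ?_ <;> fun_prop
  have hprod := (indepFun_iff_map_prod_eq_prod_map_map hzm (hm n)).1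
    (indepFun_stoppedNode (ξ₀ := ξ₀) (G := G) (m := m) (r := r) hb hσ hθ hm n)
  calc _ = ∫⁻ ω, F (z ω, θ n ω) ∂P := by
        refine lintegral_congr fun ω => ?_
        simp only [F, hz, stoppedNode, hΔc]
        split_ifs <;> rfl
    _ = ∫⁻ p, F p ∂(P.map fun ω => (z ω, θ n ω)) :=
        (lintegral_map' hF.aemeasurable (hzm.prodMk (hm n))).symm
    _ = ∫⁻ y, ∫⁻ x, F (y, x) ∂(gaussianReal 0 Δ) ∂(P.map z) := by
        rw [hprod, lintegral_prod _ hF.aemeasurable, hlaw]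
    _ ≤ ∫⁻ y, ENNReal.ofReal (1 + C * Δ) * ENNReal.ofReal ((1 + y ^ 2) ^ m) ∂(P.map z) := by
        refine lintegral_mono fun y => ?_
        by_cases hy : r ≤ (1 + y ^ 2) ^ m
        · simp only [F, if_pos hy, lintegral_const, measure_univ, mul_one]
          -- On the stopped event the value does not change, and the growth factor is at least `1`.
          refine le_mul_of_one_le_left (by simp) ?_
          rw [ENNReal.one_le_ofReal]
          have : 0 ≤ C * Δ := by positivity
          linarith
        · simp only [F, if_neg hy]
          exact lintegral_step_le hL m (hbL y) (hσL y) hΔ1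
    _ = _ := by
        rw [lintegral_const_mul _ (by fun_prop), lintegral_map' (by fun_prop) hzm]

theorem lintegral_stoppedNode_le {L : ℝ} (hL : 1 ≤ L) (hb : Continuous b) (hσ : Continuous σ)
    (hbL : ∀ y, b y ^ 2 ≤ L ^ 2 * (1 + y ^ 2)) (hσL : ∀ y, σ y ^ 2 ≤ L ^ 2 * (1 + y ^ 2))
    (hθ : iIndepFun θ P) (hm : ∀ n, AEMeasurable (θ n) P) (hG : G.mesh ≤ 1)
    (hlaw : ∀ n < G.N, P.map (θ n) = gaussianReal 0 (G.τ (n + 1) - G.τ n).toNNReal) :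
    ∀ n ≤ G.N,
      ∫⁻ ω, ENNReal.ofReal ((1 + stoppedNode b σ ξ₀ G m r (fun k => θ k ω) n ^ 2) ^ m) ∂P
        ≤ ENNReal.ofReal (Real.exp ((∫ ξ, stepRemainder L m ξ ∂(gaussianReal 0 1)) * G.τ n)
          * (1 + ξ₀ ^ 2) ^ m) := by
  intro n
  induction n with
  | zero => intro _; simp [stoppedNode, G.τ_zero]
  | succ k ih =>
    intro hk
    refine (lintegral_stoppedNode_succ_le hL hb hσ hbL hσL hθ hm hG hk (hlaw k hk)).trans ?_
    refine (mul_le_mul_right (ih (by omega)) _).trans ?_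
    set C := ∫ ξ, stepRemainder L m ξ ∂(gaussianReal 0 1)
    rw [← ENNReal.ofReal_mul' (by positivity), ← mul_assoc]
    gcongr
    calc (1 + C * (G.τ (k + 1) - G.τ k)) * Real.exp (C * G.τ k)
        ≤ Real.exp (C * (G.τ (k + 1) - G.τ k)) * Real.exp (C * G.τ k) := by
          gcongr
          rw [add_comm]
          exact Real.add_one_le_exp _
      _ = Real.exp (C * G.τ (k + 1)) := by rw [← Real.exp_add]; congr 1; ring

/-- Moment bounds for the Euler scheme, uniformly in time and in the grid. -/
theorem exists_lintegral_norm_linearOfIncr_le (hT : 0 < T) {L : ℝ} (hL : 1 ≤ L) (hb : Continuous b)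
    (hσ : Continuous σ) (hbL : ∀ y, b y ^ 2 ≤ L ^ 2 * (1 + y ^ 2))
    (hσL : ∀ y, σ y ^ 2 ≤ L ^ 2 * (1 + y ^ 2)) (ξ₀ : ℝ) (P : Measure Ω) [IsProbabilityMeasure P]
    (p : ℕ) :
    ∃ C : ℝ, 0 ≤ C ∧ ∀ (G : TimeGrid T) (θ : ℕ → Ω → ℝ), G.mesh ≤ 1 → iIndepFun θ P →
      (∀ n, AEMeasurable (θ n) P) →
      (∀ n < G.N, P.map (θ n) = gaussianReal 0 (G.τ (n + 1) - G.τ n).toNNReal) →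
      ∫⁻ ω, ENNReal.ofReal ((1 + ‖linearOfIncr b σ ξ₀ G (fun k => θ k ω)‖) ^ p) ∂P
        ≤ ENNReal.ofReal C := by
  set K := Real.exp ((∫ ξ, stepRemainder L p ξ ∂(gaussianReal 0 1)) * T) * (1 + ξ₀ ^ 2) ^ p
  have hK : 0 ≤ K := by positivity
  refine ⟨1 + 2 ^ p * K, by positivity, fun G θ hG hθ hm hlaw => ?_⟩
  have hY : AEMeasurable (fun ω => (1 + ‖linearOfIncr b σ ξ₀ G (fun k => θ k ω)‖) ^ p) P := by
    have h1 : Continuous fun d => (1 + ‖linearOfIncr b σ ξ₀ G d‖) ^ p := by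
      have := continuous_linearOfIncr (ξ₀ := ξ₀) (G := G) hb hσ
      fun_prop
    exact h1.measurable.comp_aemeasurable (aemeasurable_pi_lambda _ hm)
  refine lintegral_ofReal_le_of_meas_le (fun ω => by positivity) hY (by positivity) fun r hr => ?_
  have hr0 : 0 < r := by linarith
  -- Since `(1 + |y|)² ≤ 2 (1 + y²)`, exceeding `r` for `(1 + |y|) ^ p` forces `(1 + y²) ^ p ≥ R`.
  -- Markov's inequality at level `R` then gives the integrable tail `2 ^ p * K * r⁻²`.
  set R := r ^ 2 / 2 ^ p with hR
  have hR0 : 0 < R := by positivity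
  have hsub : {ω | r ≤ (1 + ‖linearOfIncr b σ ξ₀ G (fun k => θ k ω)‖) ^ p} ⊆
      {ω | ENNReal.ofReal R ≤
        ENNReal.ofReal ((1 + stoppedNode b σ ξ₀ G p R (fun k => θ k ω) G.N ^ 2) ^ p)} := by
    intro ω hω
    rw [mem_ofPred_eq] at hω ⊢
    refine ENNReal.ofReal_le_ofReal (le_stoppedNode_of_exists _ _ ?_)
    set d := fun k => θ k ω
    obtain ⟨n, hn, hmax⟩ := Finset.exists_max_image (Finset.range (G.N + 1))
      (fun n => |nodeOfIncr b σ ξ₀ G d n|) ⟨0, by simp⟩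
    refine ⟨n, by simpa [Nat.lt_succ_iff] using hn, ?_⟩
    have h1 : ‖linearOfIncr b σ ξ₀ G d‖ ≤ |nodeOfIncr b σ ξ₀ G d n| :=
      norm_linearOfIncr_le hT fun k hk => hmax k (by simpa [Nat.lt_succ_iff] using hk)
    set y := nodeOfIncr b σ ξ₀ G d n
    rw [hR, div_le_iff₀ (by positivity)]
    calc r ^ 2 ≤ ((1 + ‖linearOfIncr b σ ξ₀ G d‖) ^ p) ^ 2 := by gcongr
      _ ≤ ((1 + |y|) ^ p) ^ 2 := by gcongr
      _ = ((1 + |y|) ^ 2) ^ p := by rw [← pow_mul, ← pow_mul, mul_comm]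
      _ ≤ ((1 + y ^ 2) * 2) ^ p := by
          gcongr
          nlinarith [sq_abs y, sq_nonneg (1 - |y|)]
      _ = _ := mul_pow _ _ _
  refine (measure_mono hsub).trans ?_
  have hzm : AEMeasurable (fun ω => ENNReal.ofReal
      ((1 + stoppedNode b σ ξ₀ G p R (fun k => θ k ω) G.N ^ 2) ^ p)) P := by
    have h1 := (measurable_stoppedNode (ξ₀ := ξ₀) (G := G) (m := p) (r := R) hb hσ G.N)
    have h2 : Measurable fun d => ENNReal.ofReal
      ((1 + stoppedNode b σ ξ₀ G p R d G.N ^ 2) ^ p) := by fun_prop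
    exact h2.comp_aemeasurable (aemeasurable_pi_lambda _ hm)
  refine (meas_ge_le_lintegral_div hzm (by simpa using hR0) (by simp)).trans ?_
  refine (ENNReal.div_le_div_right
    (lintegral_stoppedNode_le hL hb hσ hbL hσL hθ hm hG hlaw G.N le_rfl) _).trans ?_
  rw [G.τ_last, ← ENNReal.ofReal_div_of_pos hR0]
  refine ENNReal.ofReal_le_ofReal (le_of_eq ?_)
  rw [hR, Real.rpow_neg hr0.le, Real.rpow_two]
  field_simp
  rfl

end StoppedChain

/-! ### Brownian bridges on the grid intervals: covariances and independence. -/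

/-- The point of `[t n, t (n + 1)]` with relative position `u ∈ [0, 1]`. -/
def bridgePoint (t : ℕ → ℝ≥0) (n : ℕ) (u : unitInterval) : ℝ≥0 :=
  t n + unitInterval.toNNReal u * (t (n + 1) - t n)

/-- The bridge of the trajectory `w` on `[t n, t (n + 1)]`, parametrized by `[0, 1]`. -/
def bridge (w : ℝ≥0 → ℝ) (t : ℕ → ℝ≥0) (n : ℕ) (u : unitInterval) : ℝ :=
  w (bridgePoint t n u) - w (t n) - u * (w (t (n + 1)) - w (t n))

section BridgePoint

variable {t : ℕ → ℝ≥0} {n : ℕ} {u v : unitInterval}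

theorem coe_bridgePoint (ht : Monotone t) : (bridgePoint t n u : ℝ) = t n
    + u * (t (n + 1) - t n) := by
  rw [bridgePoint, NNReal.coe_add, NNReal.coe_mul, NNReal.coe_sub (ht n.le_succ)]
  rfl

theorem le_bridgePoint : t n ≤ bridgePoint t n u := le_self_add

theorem bridgePoint_le (ht : Monotone t) : bridgePoint t n u ≤ t (n + 1) := by
  rw [← NNReal.coe_le_coe, coe_bridgePoint ht]
  have h1 : (t n : ℝ) ≤ t (n + 1) := ht n.le_succ
  nlinarith [u.2.1, u.2.2]

theorem bridgePoint_mono (ht : Monotone t) (h : u ≤ v) : bridgePoint t n u ≤ bridgePoint t n v := by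
  rw [← NNReal.coe_le_coe, coe_bridgePoint ht, coe_bridgePoint ht]
  have h1 : (t n : ℝ) ≤ t (n + 1) := ht n.le_succ
  have h2 : (u : ℝ) ≤ v := h
  nlinarith

theorem bridge_zero (w : ℝ≥0 → ℝ) (t : ℕ → ℝ≥0) (n : ℕ) : bridge w t n 0 = 0 := by
  have : bridgePoint t n 0 = t n := by
    have h : unitInterval.toNNReal 0 = 0 := rfl
    rw [bridgePoint, h, zero_mul, add_zero]
  simp [bridge, this]

theorem bridge_one (ht : Monotone t) (w : ℝ≥0 → ℝ) (n : ℕ) : bridge w t n 1 = 0 := by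
  have : bridgePoint t n 1 = t (n + 1) := by
    have h : unitInterval.toNNReal 1 = 1 := rfl
    rw [bridgePoint, h, one_mul, add_tsub_cancel_of_le (ht n.le_succ)]
  simp [bridge, this]

end BridgePoint

section Covariance

variable {Ω : Type*} [MeasurableSpace Ω] {P : Measure Ω} {W : ℝ≥0 → Ω → ℝ}

theorem memLp_two_sub (hW : IsPreBrownianReal W P) (s r : ℝ≥0) :
    MemLp (fun ω => W s ω - W r ω) 2 P :=
  (hW.isGaussianProcess.hasGaussianLaw_eval s).memLp_two.sub
    (hW.isGaussianProcess.hasGaussianLaw_eval r).memLp_two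

theorem memLp_two_bridge (hW : IsPreBrownianReal W P) (t : ℕ → ℝ≥0) (n : ℕ) (u : unitInterval) :
    MemLp (fun ω => bridge (W · ω) t n u) 2 P :=
  (memLp_two_sub hW _ _).sub ((memLp_two_sub hW _ _).const_mul _)

theorem isGaussianProcess_incr_bridge (hW : IsPreBrownianReal W P) (t : ℕ → ℝ≥0) :
    IsGaussianProcess (Sum.elim (fun (n : ℕ) ω => W (t (n + 1)) ω - W (t n) ω)
      (fun (p : ℕ × unitInterval) ω => bridge (W · ω) t p.1 p.2)) P := by
  classical
  refine hW.isGaussianProcess.of_isGaussianProcess ?_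
  rintro (n | ⟨n, u⟩)
  · refine ⟨{t n, t (n + 1)}, ContinuousLinearMap.proj (R := ℝ) (φ := fun _ => ℝ) ⟨t (n + 1),
      by simp⟩
      - ContinuousLinearMap.proj (R := ℝ) (φ := fun _ => ℝ) ⟨t n, by simp⟩, fun ω => ?_⟩
    simp
  · refine ⟨{t n, t (n + 1), bridgePoint t n u},
      ContinuousLinearMap.proj (R := ℝ) (φ := fun _ => ℝ) ⟨bridgePoint t n u, by simp⟩
      - ContinuousLinearMap.proj (R := ℝ) (φ := fun _ => ℝ) ⟨t n, by simp⟩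
      - (u : ℝ) • (ContinuousLinearMap.proj (R := ℝ) (φ := fun _ => ℝ) ⟨t (n + 1), by simp⟩
        - ContinuousLinearMap.proj (R := ℝ) (φ := fun _ => ℝ) ⟨t n, by simp⟩), fun ω => ?_⟩
    simp [bridge]

theorem integral_bridge (hW : IsPreBrownianReal W P) (t : ℕ → ℝ≥0) (n : ℕ) (u : unitInterval) :
    ∫ ω, bridge (W · ω) t n u ∂P = 0 := by
  have hi := hW.integrable_eval
  have h0 := hW.integral_eval
  simp only [bridge]
  rw [integral_sub (by exact (hi _).sub (hi _)) (by exact ((hi _).sub (hi _)).const_mul _),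
    integral_const_mul,
    integral_sub (hi _) (hi _), integral_sub (hi _) (hi _), h0, h0, h0]
  simp

theorem hasGaussianLaw_bridge (hW : IsPreBrownianReal W P) (t : ℕ → ℝ≥0) {ι : Type*} [Fintype ι]
    (q : ι → ℕ × unitInterval) : HasGaussianLaw (fun ω i => bridge (W · ω) t (q i).1
      (q i).2) P := by
  have h := (isGaussianProcess_incr_bridge hW t).comp_right fun i => Sum.inr (q i)
  let L : (↥(Finset.univ : Finset ι) → ℝ) →L[ℝ] ι → ℝ :=
    ContinuousLinearMap.pi fun i =>
      ContinuousLinearMap.proj (R := ℝ) (φ := fun _ => ℝ) ⟨i, Finset.mem_univ i⟩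
  exact (h.hasGaussianLaw Finset.univ).map L

variable [IsProbabilityMeasure P]

theorem covariance_sub_sub (hW : IsPreBrownianReal W P) (s r a c : ℝ≥0) :
    cov[fun ω => W s ω - W r ω, fun ω => W a ω - W c ω; P]
      = ((min s a : ℝ≥0) : ℝ) - (min s c : ℝ≥0) - ((min r a : ℝ≥0) - (min r c : ℝ≥0)) := by
  have hm : ∀ s, MemLp (fun ω => W s ω) 2 P := fun s =>
    (hW.isGaussianProcess.hasGaussianLaw_eval s).memLp_two
  rw [covariance_fun_sub_fun_sub (hm _) (hm _) (hm _) (hm _)]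
  simp only [hW.covariance_fun_eval]
  ring

theorem covariance_sub_bridge (hW : IsPreBrownianReal W P) (s r : ℝ≥0) (t : ℕ → ℝ≥0) (n : ℕ)
    (u : unitInterval) :
    cov[fun ω => W s ω - W r ω, fun ω => bridge (W · ω) t n u; P]
      = ((min s (bridgePoint t n u) : ℝ≥0) : ℝ) - (min s (t n) : ℝ≥0)
          - ((min r (bridgePoint t n u) : ℝ≥0) - (min r (t n) : ℝ≥0))
        - u * ((min s (t (n + 1)) : ℝ≥0) - (min s (t n) : ℝ≥0)
          - ((min r (t (n + 1)) : ℝ≥0) - (min r (t n) : ℝ≥0))) := by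
  simp only [bridge]
  rw [covariance_fun_sub_right (memLp_two_sub hW _ _) (memLp_two_sub hW _ _)
    ((memLp_two_sub hW _ _).const_mul _), covariance_const_mul_right, covariance_sub_sub hW,
    covariance_sub_sub hW]

theorem covariance_bridge_left (hW : IsPreBrownianReal W P) (t : ℕ → ℝ≥0) (n : ℕ) (u : unitInterval)
    {Z : Ω → ℝ} (hZ : MemLp Z 2 P) :
    cov[fun ω => bridge (W · ω) t n u, Z; P]
      = cov[fun ω => W (bridgePoint t n u) ω - W (t n) ω, Z; P]
        - u * cov[fun ω => W (t (n + 1)) ω - W (t n) ω, Z; P] := by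
  simp only [bridge]
  rw [covariance_fun_sub_left (memLp_two_sub hW _ _) ((memLp_two_sub hW _ _).const_mul _) hZ,
    covariance_const_mul_left]

variable {t : ℕ → ℝ≥0}

theorem covariance_sub_bridge_of_le (ht : Monotone t) (hW : IsPreBrownianReal W P) {s r : ℝ≥0}
    {n : ℕ} (u : unitInterval)
    (hs : s ≤ t n) (hr : r ≤ t n) :
    cov[fun ω => W s ω - W r ω, fun ω => bridge (W · ω) t n u; P] = 0 := by
  have h1 : t n ≤ t (n + 1) := ht n.le_succ
  have h2 := le_bridgePoint (t := t) (n := n) (u := u)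
  rw [covariance_sub_bridge hW]
  rw [min_eq_left hs, min_eq_left hr, min_eq_left (hs.trans h1), min_eq_left (hr.trans h1),
    min_eq_left (hs.trans h2), min_eq_left (hr.trans h2)]
  ring

theorem covariance_sub_bridge_of_ge (ht : Monotone t) (hW : IsPreBrownianReal W P) {s r : ℝ≥0}
    {n : ℕ} (u : unitInterval)
    (hs : t (n + 1) ≤ s) (hr : t (n + 1) ≤ r) :
    cov[fun ω => W s ω - W r ω, fun ω => bridge (W · ω) t n u; P] = 0 := by
  have h1 : t n ≤ t (n + 1) := ht n.le_succ
  have h2 := bridgePoint_le ht (n := n) (u := u)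
  rw [covariance_sub_bridge hW]
  rw [min_eq_right hs, min_eq_right hr, min_eq_right (h1.trans hs), min_eq_right (h1.trans hr),
    min_eq_right (h2.trans hs), min_eq_right (h2.trans hr)]
  ring

/-- On the same interval, subtracting the linear interpolation is exactly what cancels the
covariance with the increment; for different intervals the increments involved do not overlap. -/
theorem covariance_incr_bridge (ht : Monotone t) (hW : IsPreBrownianReal W P) (n m : ℕ)
    (u : unitInterval) :
    cov[fun ω => W (t (n + 1)) ω - W (t n) ω, fun ω => bridge (W · ω) t m u; P] = 0 := by
  rcases lt_trichotomy n m with h | rfl | h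
  · exact covariance_sub_bridge_of_le ht hW u (ht h) (ht h.le)
  · have h1 : t n ≤ t (n + 1) := ht n.le_succ
    have h2 := bridgePoint_le ht (n := n) (u := u)
    have h3 := le_bridgePoint (t := t) (n := n) (u := u)
    rw [covariance_sub_bridge hW]
    rw [min_eq_right h2, min_eq_right h1, min_eq_left h3, min_self, min_self, min_eq_left h1,
      coe_bridgePoint ht]
    ring
  · exact covariance_sub_bridge_of_ge ht hW u (ht (by omega)) (ht h)

theorem covariance_bridge_bridge_of_ne (ht : Monotone t) (hW : IsPreBrownianReal W P) {n m : ℕ}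
    (hnm : n ≠ m)
    (u v : unitInterval) :
    cov[fun ω => bridge (W · ω) t n u, fun ω => bridge (W · ω) t m v; P] = 0 := by
  rw [covariance_bridge_left hW t n u (memLp_two_bridge hW t m v), covariance_incr_bridge ht hW]
  rcases lt_or_gt_of_ne hnm with h | h
  · rw [covariance_sub_bridge_of_le ht hW v ((bridgePoint_le ht).trans (ht h)) (ht h.le)]
    ring
  · rw [covariance_sub_bridge_of_ge ht hW v ((ht h).trans le_bridgePoint) (ht h)]
    ring

/-- The interval enters only through its length. This is why all bridges can be compared with one
bridge on `[0, T]`, rescaled by the square root of the ratio of lengths. -/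
theorem covariance_bridge_bridge_self (ht : Monotone t) (hW : IsPreBrownianReal W P) (n : ℕ)
    (u v : unitInterval) :
    cov[fun ω => bridge (W · ω) t n u, fun ω => bridge (W · ω) t n v; P]
      = (t (n + 1) - t n) * (min (u : ℝ) v - u * v) := by
  have h1 : t n ≤ t (n + 1) := ht n.le_succ
  have hu := le_bridgePoint (t := t) (n := n) (u := u)
  have hv := le_bridgePoint (t := t) (n := n) (u := v)
  rw [covariance_bridge_left hW t n u (memLp_two_bridge hW t n v), covariance_incr_bridge ht hW,
    covariance_sub_bridge hW]
  rw [min_eq_right hu, min_eq_left hv, min_self, min_eq_left h1,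
    min_eq_left (bridgePoint_le ht (n := n) (u := u))]
  rcases le_total u v with h | h
  · rw [min_eq_left (bridgePoint_mono ht h), min_eq_left (show (u : ℝ) ≤ v from h),
      coe_bridgePoint ht]
    ring
  · rw [min_eq_right (bridgePoint_mono ht h), min_eq_right (show (v : ℝ) ≤ u from h),
      coe_bridgePoint ht, coe_bridgePoint ht]
    ring

theorem integral_bridge_mul_bridge (hW : IsPreBrownianReal W P) (t : ℕ → ℝ≥0) (n m : ℕ)
    (u v : unitInterval) :
    ∫ ω, bridge (W · ω) t n u * bridge (W · ω) t m v ∂P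
      = cov[fun ω => bridge (W · ω) t n u, fun ω => bridge (W · ω) t m v; P] := by
  rw [covariance_eq_sub (memLp_two_bridge hW t n u) (memLp_two_bridge hW t m v),
    integral_bridge hW, zero_mul, sub_zero]
  rfl

/-- For a jointly Gaussian family, vanishing covariance implies independence. This permits freezing
the Euler nodes while averaging over the bridges. -/
theorem indepFun_incr_bridge (ht : Monotone t) (hW : IsPreBrownianReal W P) :
    IndepFun (fun ω (n : ℕ) => W (t (n + 1)) ω - W (t n) ω)
      (fun ω (p : ℕ × unitInterval) => bridge (W · ω) t p.1 p.2) P :=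
  (isGaussianProcess_incr_bridge hW t).indepFun_of_covariance_eq_zero
    (fun _ => (memLp_two_sub hW _ _).aemeasurable)
    (fun p => (memLp_two_bridge hW t p.1 p.2).aemeasurable)
    (fun n p => covariance_incr_bridge ht hW n p.1 p.2)

end Covariance

/-! ### Bernstein polynomials as a finite-dimensional approximation of paths. -/

section Bernstein

/-- The combination of the Bernstein polynomials of degree `M` with coefficients `x`. -/
def bernsteinSum (M : ℕ) (x : Fin (M + 1) → ℝ) : C(unitInterval, ℝ) := ∑ k : Fin (M + 1),
    x k • bernstein M k

variable {M : ℕ}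

theorem bernsteinSum_apply (x : Fin (M + 1) → ℝ) (u : unitInterval) :
    bernsteinSum M x u = ∑ k : Fin (M + 1), x k * bernstein M k u := by
  simp [bernsteinSum, ContinuousMap.sum_apply]

theorem bernsteinApproximation_eq_bernsteinSum (f : C(unitInterval, ℝ)) :
    bernsteinApproximation M f = bernsteinSum M fun k => f (bernstein.z k) := by
  ext u
  rw [bernsteinApproximation.apply, bernsteinSum_apply]
  exact Finset.sum_congr rfl fun k _ => mul_comm _ _

/-- Bernstein polynomials are nonnegative and sum to `1`, so passing to the approximation does not
increase sup bounds. -/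
theorem norm_bernsteinSum_le {x : Fin (M + 1) → ℝ} {R : ℝ} (hR : ∀ k, |x k| ≤ R) :
    ‖bernsteinSum M x‖ ≤ R := by
  rw [ContinuousMap.norm_le _ ((abs_nonneg _).trans (hR 0))]
  intro u
  rw [bernsteinSum_apply]
  calc ‖∑ k : Fin (M + 1), x k * bernstein M k u‖ ≤ ∑ k : Fin (M + 1), R * bernstein M k u := by
        refine norm_sum_le_of_le _ fun k _ => ?_
        rw [norm_mul, Real.norm_of_nonneg bernstein_nonneg]
        exact mul_le_mul_of_nonneg_right (hR k) bernstein_nonneg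
    _ = R := by rw [← Finset.mul_sum, bernstein.probability, mul_one]

theorem bernsteinSum_zero (x : Fin (M + 1) → ℝ) : bernsteinSum M x 0 = x 0 := by
  simp [bernsteinSum_apply, Fin.sum_univ_succ, bernstein_apply]

theorem bernsteinSum_one (x : Fin (M + 1) → ℝ) :
    bernsteinSum M x 1 = x (Fin.last M) := by
  simp [bernsteinSum_apply, Fin.sum_univ_castSucc, bernstein_apply, Nat.sub_eq_zero_iff_le]

theorem continuous_bernsteinSum : Continuous (bernsteinSum M) := by
  unfold bernsteinSum; fun_prop

/-- The continuous function `g`, or `0` if `g` is not continuous. -/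
def ofFun (g : unitInterval → ℝ) : C(unitInterval, ℝ) :=
  open Classical in if h : Continuous g then ⟨g, h⟩ else 0

theorem ofFun_apply {g : unitInterval → ℝ} (h : Continuous g)
    (u : unitInterval) : ofFun g u = g u := by
  rw [ofFun, dif_pos h]; rfl

theorem ofFun_apply_eq_zero {g : unitInterval → ℝ} {u : unitInterval}
    (h : g u = 0) : ofFun g u = 0 := by
  by_cases hg : Continuous g
  · rw [ofFun_apply hg, h]
  · rw [ofFun, dif_neg hg]; rfl

end Bernstein

/-! ### Grid times as a monotone sequence, and uniform grids. -/

section Time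

variable {T : ℝ} (G : TimeGrid T)

/-- The grid points as a monotone sequence that is constant from the index `N` on. -/
def TimeGrid.time (n : ℕ) : ℝ≥0 := (G.τ (min n G.N)).toNNReal

theorem TimeGrid.time_of_le {n : ℕ} (hn : n ≤ G.N) : G.time n = (G.τ n).toNNReal := by
  rw [TimeGrid.time, min_eq_left hn]

theorem TimeGrid.coe_time {n : ℕ} (hn : n ≤ G.N) : (G.time n : ℝ) = G.τ n := by
  rw [G.time_of_le hn, Real.coe_toNNReal _ (G.τ_nonneg hn)]

theorem TimeGrid.monotone_time : Monotone G.time := fun _ _ h =>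
  Real.toNNReal_mono (G.τ_le_of_le (min_le_min_right _ h) (min_le_right _ _))

theorem TimeGrid.time_le (n : ℕ) : G.time n ≤ T.toNNReal :=
  Real.toNNReal_mono (G.τ_le (min_le_right _ _))

/-- The grid of `M` steps of equal length. -/
def uniformGrid (hT : 0 < T) {M : ℕ} (hM : 0 < M) : TimeGrid T where
  N := M
  τ n := n * T / M
  τ_zero := by simp
  τ_last := by field_simp
  τ_lt n _ := by
    have : (0 : ℝ) < M := by exact_mod_cast hM
    push_cast
    gcongr
    linarith

theorem mesh_uniformGrid_le (hT : 0 < T) {M : ℕ} (hM : 0 < M) :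
    (uniformGrid hT hM).mesh ≤ T / M := by
  have : Nonempty (Fin (uniformGrid hT hM).N) := ⟨⟨0, hM⟩⟩
  refine ciSup_le fun n => le_of_eq ?_
  simp only [uniformGrid]
  push_cast
  ring

end Time

/-! ### Pathwise bounds by the supremum of the Brownian trajectory. -/

section Trajectory

variable {Ω : Type*} {W : ℝ≥0 → Ω → ℝ}

/-- The trajectory of `W` on `[0, T]`, rescaled to `[0, 1]`. -/
def scaledPath (W : ℝ≥0 → Ω → ℝ) (T : ℝ) (ω : Ω) : C(unitInterval, ℝ) :=
  ofFun fun u => W (T.toNNReal * unitInterval.toNNReal u) ω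

theorem continuous_toNNReal : Continuous unitInterval.toNNReal := by
  unfold unitInterval.toNNReal; fun_prop

theorem scaledPath_apply {T : ℝ} {ω : Ω} (h : Continuous (W · ω)) (u : unitInterval) :
    scaledPath W T ω u = W (T.toNNReal * unitInterval.toNNReal u) ω :=
  ofFun_apply (h.comp (continuous_const.mul continuous_toNNReal)) u

theorem abs_le_norm_scaledPath {T : ℝ} (hT : 0 < T) {ω : Ω} (h : Continuous (W · ω)) {s : ℝ≥0}
    (hs : s ≤ T.toNNReal) : |W s ω| ≤ ‖scaledPath W T ω‖ := by
  have hT' : 0 < T.toNNReal := Real.toNNReal_pos.2 hT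
  have hu : ((s / T.toNNReal : ℝ≥0) : ℝ) ∈ unitInterval :=
    ⟨NNReal.coe_nonneg _, by exact_mod_cast div_le_one_of_le₀ hs zero_le⟩
  have h1 := (scaledPath W T ω).norm_coe_le_norm ⟨_, hu⟩
  rw [scaledPath_apply h] at h1
  have h2 : T.toNNReal * unitInterval.toNNReal ⟨_, hu⟩ = s := by
    have : unitInterval.toNNReal ⟨_, hu⟩ = s / T.toNNReal := rfl
    rw [this, mul_div_cancel₀ _ hT'.ne']
  rwa [h2] at h1

/-- The bridges of `W` as random elements of `C([0, 1], ℝ)`. -/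
def bridgePath (W : ℝ≥0 → Ω → ℝ) (t : ℕ → ℝ≥0) (n : ℕ) (ω : Ω) : C(unitInterval, ℝ) :=
  ofFun (bridge (W · ω) t n)

theorem bridgePath_zero (t : ℕ → ℝ≥0) (n : ℕ) (ω : Ω) : bridgePath W t n ω 0 = 0 :=
  ofFun_apply_eq_zero (bridge_zero _ _ _)

theorem bridgePath_one {t : ℕ → ℝ≥0} (ht : Monotone t) (n : ℕ) (ω : Ω) :
    bridgePath W t n ω 1 = 0 :=
  ofFun_apply_eq_zero (bridge_one ht _ _)

theorem bridgePath_apply {ω : Ω} (h : Continuous (W · ω)) (t : ℕ → ℝ≥0) (n : ℕ) (u : unitInterval) :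
    bridgePath W t n ω u = bridge (W · ω) t n u := by
  refine ofFun_apply ?_ u
  have := continuous_toNNReal
  unfold bridge bridgePoint
  fun_prop

/-- The bridge combines four values of `W`, each with a coefficient of modulus at most `1`. -/
theorem abs_bridge_le {T : ℝ} (hT : 0 < T) {ω : Ω} (h : Continuous (W · ω)) {t : ℕ → ℝ≥0}
    (ht : Monotone t) (htT : ∀ n, t n ≤ T.toNNReal) (n : ℕ) (u : unitInterval) :
    |bridge (W · ω) t n u| ≤ 4 * ‖scaledPath W T ω‖ := by
  have h1 := abs_le_norm_scaledPath hT h ((bridgePoint_le ht (n := n) (u := u)).trans (htT _))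
  have h2 := abs_le_norm_scaledPath hT h (htT n)
  have h3 := abs_le_norm_scaledPath hT h (htT (n + 1))
  have hu := u.2
  have h4 : |(u : ℝ) * (W (t (n + 1)) ω - W (t n) ω)| ≤ 1 * |W (t (n + 1)) ω - W (t n) ω| := by
    rw [abs_mul, abs_of_nonneg hu.1]
    exact mul_le_mul_of_nonneg_right hu.2 (abs_nonneg _)
  have h5 := abs_sub (W (t (n + 1)) ω) (W (t n) ω)
  have h6 := abs_sub (W (bridgePoint t n u) ω) (W (t n) ω)
  refine (abs_sub _ _).trans ?_
  linarith

theorem tendsto_bernsteinSum_scaledPath {T : ℝ} {ω : Ω} (h : Continuous (W · ω)) :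
    Tendsto (fun M => ‖bernsteinSum M fun k =>
      W (T.toNNReal * unitInterval.toNNReal (bernstein.z k)) ω‖) atTop
      (𝓝 ‖scaledPath W T ω‖) := by
  have h1 := (bernsteinApproximation_uniform (scaledPath W T ω)).norm
  refine h1.congr fun M => ?_
  rw [bernsteinApproximation_eq_bernsteinSum]
  simp only [scaledPath_apply h]

/-- The Bernstein coefficients are the values of `W` at the uniform grid times, and the Euler scheme
with zero drift and unit diffusion reproduces these values. Thus moment bounds for Euler schemes
apply to Brownian motion itself. -/
theorem norm_bernsteinSum_scaledPath_le {T : ℝ} (hT : 0 < T) {M : ℕ} (hM : 0 < M) {ω : Ω}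
    (h0 : W 0 ω = 0) :
    ‖bernsteinSum M fun k => W (T.toNNReal * unitInterval.toNNReal (bernstein.z k)) ω‖
      ≤ ‖linearOfIncr (fun _ => 0) (fun _ => 1) 0 (uniformGrid hT hM) (fun n =>
        W ((uniformGrid hT hM).time (n + 1)) ω - W ((uniformGrid hT hM).time n) ω)‖ := by
  set G := uniformGrid hT hM with hG
  refine norm_bernsteinSum_le fun k => ?_
  have hk : (k : ℕ) ≤ G.N := Nat.lt_succ_iff.1 k.2
  refine le_trans (le_of_eq ?_) (abs_nodeOfIncr_le hT _ hk)
  have hnode : ∀ n, nodeOfIncr (fun _ => 0) (fun _ => 1) 0 G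
      (fun n => W (G.time (n + 1)) ω - W (G.time n) ω) n = W (G.time n) ω := by
    intro n
    induction n with
    | zero =>
      have : G.time 0 = 0 := by rw [G.time_of_le (Nat.zero_le _), G.τ_zero, Real.toNNReal_zero]
      rw [this, h0]; rfl
    | succ n ih => rw [nodeOfIncr, ih]; ring
  rw [hnode]
  congr 2
  rw [← NNReal.coe_inj, G.coe_time hk, NNReal.coe_mul, Real.coe_toNNReal _ hT.le]
  show T * ((k : ℝ) / M) = k * T / M
  ring

end Trajectory

/-! ### Moments of the supremum of Brownian motion. -/

section Brownian

variable {Ω : Type*} [MeasurableSpace Ω] {P : Measure Ω} {W : ℝ≥0 → Ω → ℝ}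

theorem map_incr_eq_gaussianReal (hW : IsPreBrownianReal W P) {T : ℝ} (G : TimeGrid T) {n : ℕ}
    (hn : n < G.N) :
    P.map (fun ω => W (G.time (n + 1)) ω - W (G.time n) ω)
      = gaussianReal 0 (G.τ (n + 1) - G.τ n).toNNReal := by
  have h := (hW.hasLaw_sub (G.time (n + 1)) (G.time n)).map_eq
  have h0 := sub_pos.2 (G.τ_lt n hn)
  have hd : nndist (G.time (n + 1) : ℝ) (G.time n : ℝ) = (G.τ (n + 1) - G.τ n).toNNReal := by
    rw [← NNReal.coe_inj, coe_nndist, Real.dist_eq, G.coe_time hn, G.coe_time hn.le,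
      abs_of_pos h0, Real.coe_toNNReal _ h0.le]
  rw [← hd]
  exact h

theorem aemeasurable_bernsteinSum_scaledPath (hW : IsPreBrownianReal W P) (T : ℝ) (M : ℕ) :
    AEMeasurable (fun ω => ‖bernsteinSum M fun k =>
      W (T.toNNReal * unitInterval.toNNReal (bernstein.z k)) ω‖) P :=
  (continuous_bernsteinSum.norm.measurable).comp_aemeasurable
    (aemeasurable_pi_lambda _ fun _ => hW.aemeasurable _)

theorem aemeasurable_norm_scaledPath (hW : IsBrownianReal W P) (T : ℝ) :
    AEMeasurable (fun ω => ‖scaledPath W T ω‖) P :=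
  aemeasurable_of_tendsto_metrizable_ae atTop
    (fun M => aemeasurable_bernsteinSum_scaledPath hW.toIsPreBrownianReal T M)
    (hW.cont.mono fun _ h => tendsto_bernsteinSum_scaledPath h)

theorem exists_lintegral_norm_scaledPath_le [IsProbabilityMeasure P] (hW : IsBrownianReal W P)
    {T : ℝ} (hT : 0 < T) (p : ℕ) :
    ∃ C : ℝ, 0 ≤ C ∧ ∫⁻ ω, ENNReal.ofReal ((1 + ‖scaledPath W T ω‖) ^ p) ∂P ≤ ENNReal.ofReal C := by
  have hW' := hW.toIsPreBrownianReal
  obtain ⟨C, hC, hbd⟩ := exists_lintegral_norm_linearOfIncr_le (b := fun _ => 0) (σ := fun _ => 1)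
    hT (le_refl (1 : ℝ)) continuous_const continuous_const (fun y => by nlinarith [sq_nonneg y])
    (fun y => by nlinarith [sq_nonneg y]) 0 P p
  refine ⟨C, hC, ?_⟩
  set f : ℕ → Ω → ℝ≥0∞ := fun M ω => ENNReal.ofReal ((1 + ‖bernsteinSum M fun k =>
      W (T.toNNReal * unitInterval.toNNReal (bernstein.z k)) ω‖) ^ p) with hf
  have hfm : ∀ M, AEMeasurable (f M) P := fun M => by
    have := aemeasurable_bernsteinSum_scaledPath hW' T M
    fun_prop
  have hlim : ∀ᵐ ω ∂P, ENNReal.ofReal ((1 + ‖scaledPath W T ω‖) ^ p)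
      = liminf (fun M => f M ω) atTop := by
    filter_upwards [hW.cont] with ω h
    refine (Tendsto.liminf_eq ?_).symm
    exact ENNReal.tendsto_ofReal (((tendsto_bernsteinSum_scaledPath h).const_add 1).pow p)
  rw [lintegral_congr_ae hlim]
  -- Fatou's lemma transfers the bound, which is uniform in the number of steps, to the limit.
  refine (lintegral_liminf_le' hfm).trans ?_
  refine liminf_le_of_frequently_le' (Eventually.frequently ?_)
  -- At least `T` steps are needed for the mesh `T / M` not to exceed `1`.
  filter_upwards [eventually_ge_atTop (max 1 ⌈T⌉₊)] with M hM
  have hM0 : 0 < M := lt_of_lt_of_le zero_lt_one ((le_max_left _ _).trans hM)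
  have hTM : T ≤ M := (Nat.le_ceil T).trans (by exact_mod_cast (le_max_right _ _).trans hM)
  refine le_trans (lintegral_mono_ae ?_) (hbd (uniformGrid hT hM0) (fun n ω =>
    W ((uniformGrid hT hM0).time (n + 1)) ω - W ((uniformGrid hT hM0).time n) ω) ?_ ?_ ?_ ?_)
  · filter_upwards [hW'.eval_zero_ae_eq_zero] with ω h0
    refine ENNReal.ofReal_le_ofReal ?_
    gcongr
    exact norm_bernsteinSum_scaledPath_le hT hM0 h0
  · refine (mesh_uniformGrid_le hT hM0).trans ?_
    rw [div_le_one (by exact_mod_cast hM0)]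
    exact hTM
  · exact hW'.hasIndepIncrements.nat (uniformGrid hT hM0).monotone_time
  · exact fun n => (memLp_two_sub hW' _ _).aemeasurable
  · exact fun n hn => map_incr_eq_gaussianReal hW' _ hn

theorem integrable_one_add_norm_scaledPath_pow [IsProbabilityMeasure P] (hW : IsBrownianReal W P)
    {T : ℝ} (hT : 0 < T) (p : ℕ) : Integrable (fun ω => (1 + ‖scaledPath W T ω‖) ^ p) P := by
  obtain ⟨C, _, hC⟩ := exists_lintegral_norm_scaledPath_le hW hT p
  have hm := aemeasurable_norm_scaledPath hW T
  refine ⟨AEMeasurable.aestronglyMeasurable (by fun_prop), ?_⟩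
  rw [hasFiniteIntegral_iff_ofReal (ae_of_all _ fun ω => by positivity)]
  exact hC.trans_lt ENNReal.ofReal_lt_top

end Brownian

/-! ### Assembling approximate bridges into one path. -/

section PathOfBridge

variable {T : ℝ} (G : TimeGrid T) (M : ℕ)

/-- The path in `C([0, T], ℝ)` which on `[τ n, τ (n + 1)]` is `c n` times the combination of
Bernstein polynomials with coefficients `x (n, ·)`. -/
def pathOfBridge (c : ℕ → ℝ) : (Fin G.N × Fin (M + 1) → ℝ) →L[ℝ] C(Icc (0 : ℝ) T, ℝ) :=
  ∑ i : Fin G.N × Fin (M + 1), (ContinuousLinearMap.proj (R := ℝ) (φ := fun _ => ℝ) i).smulRight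
    (c i.1 • (bernstein M i.2).comp (gridMap G i.1))

variable {G M}

theorem pathOfBridge_apply (c : ℕ → ℝ) (x : Fin G.N × Fin (M + 1) → ℝ) :
    pathOfBridge G M c x
      = ∑ n : Fin G.N, ∑ k : Fin (M + 1), (c n * x (n, k)) • (bernstein M k).comp
        (gridMap G n) := by
  rw [← Fintype.sum_prod_type' (f := fun (n : Fin G.N) (k : Fin (M + 1)) =>
    (c n * x (n, k)) • (bernstein M k).comp (gridMap G n))]
  simp [pathOfBridge, smul_smul, mul_comm, sum_apply]

theorem comp_gridMap_smul_bernsteinSum (c : ℝ) (y : Fin (M + 1) → ℝ) (n : ℕ) :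
    (c • bernsteinSum M y).comp (gridMap G n)
      = ∑ k : Fin (M + 1), (c * y k) • (bernstein M k).comp (gridMap G n) := by
  ext t
  simp [bernsteinSum_apply, ContinuousMap.sum_apply, Finset.mul_sum, mul_assoc]

theorem pathOfBridge_eq_sum_comp (c : ℕ → ℝ) (y : ℕ → Fin (M + 1) → ℝ) :
    pathOfBridge G M c (fun i => y i.1 i.2)
      = ∑ n ∈ Finset.range G.N, (c n • bernsteinSum M (y n)).comp (gridMap G n) := by
  rw [pathOfBridge_apply, Finset.sum_range]
  simp only [comp_gridMap_smul_bernsteinSum]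

end PathOfBridge

/-! ### The quadratic form averaged over the bridges. -/

section Trace

variable {T : ℝ} {G : TimeGrid T} {Ω : Type*} [MeasurableSpace Ω] {P : Measure Ω}
  {W : ℝ≥0 → Ω → ℝ}

/-- The values at the points `k / M` of the bridges of the trajectory `w`. -/
def bridgeValues (G : TimeGrid T) (M : ℕ) (w : ℝ≥0 → ℝ) (i : Fin G.N × Fin (M + 1)) : ℝ :=
  bridge w G.time i.1 (bernstein.z i.2)

/-- The grid points of the trivial partition of `[0, T]`. -/
def trivialTime (T : ℝ) (n : ℕ) : ℝ≥0 := if n = 0 then 0 else T.toNNReal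

theorem monotone_trivialTime : Monotone (trivialTime T) := by
  intro m n h
  unfold trivialTime
  split_ifs <;> first | exact le_rfl | exact zero_le | omega

theorem trivialTime_le (n : ℕ) : trivialTime T n ≤ T.toNNReal := by
  unfold trivialTime
  split_ifs <;> first | exact le_rfl | exact zero_le

theorem integrable_bridge_mul_bridge (hW : IsPreBrownianReal W P) (t : ℕ → ℝ≥0) (n m : ℕ)
    (u v : unitInterval) :
    Integrable (fun ω => bridge (W · ω) t n u * bridge (W · ω) t m v) P :=
  (memLp_two_bridge hW t n u).integrable_mul (memLp_two_bridge hW t m v)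

variable [IsProbabilityMeasure P]

theorem integral_bridgeValues_mul (hT : 0 < T) (hW : IsPreBrownianReal W P) {M : ℕ}
    (n m : Fin G.N) (k l : Fin (M + 1)) :
    ∫ ω, bridgeValues G M (W · ω) (n, k) * bridgeValues G M (W · ω) (m, l) ∂P
      = if n = m then (G.τ (n + 1) - G.τ n) / T *
        ∫ ω, bridge (W · ω) (trivialTime T) 0 (bernstein.z k)
          * bridge (W · ω) (trivialTime T) 0 (bernstein.z l) ∂P else 0 := by
  simp only [bridgeValues]
  rw [integral_bridge_mul_bridge hW, integral_bridge_mul_bridge hW]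
  split_ifs with h
  · subst h
    rw [covariance_bridge_bridge_self G.monotone_time hW,
      covariance_bridge_bridge_self monotone_trivialTime hW, G.coe_time n.2, G.coe_time n.2.le]
    simp only [trivialTime, zero_add, one_ne_zero, if_true, if_false, NNReal.coe_zero, sub_zero,
      Real.coe_toNNReal _ hT.le]
    field_simp
  · exact covariance_bridge_bridge_of_ne G.monotone_time hW (fun e => h (Fin.ext e)) _ _

variable {E : Type*} [NormedAddCommGroup E] [NormedSpace ℝ E]

/-- The quadratic form `A`, averaged over independent bridges on the intervals of a grid, does not
change if all the bridges are replaced by rescalings of one and the same bridge and the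
off-diagonal terms are dropped. -/
theorem integral_diag_bridgeValues (hT : 0 < T) (hW : IsPreBrownianReal W P) {M : ℕ} (c : ℕ → ℝ)
    (A : E →L[ℝ] E →L[ℝ] ℝ) (g : Fin G.N → Fin (M + 1) → E) :
    ∫ ω, A (∑ n : Fin G.N, ∑ k, (c n * bridgeValues G M (W · ω) (n, k)) • g n k)
        (∑ n : Fin G.N, ∑ k, (c n * bridgeValues G M (W · ω) (n, k)) • g n k) ∂P
      = ∫ ω, ∑ n : Fin G.N,
        A (∑ k, (c n * √((G.τ (n + 1) - G.τ n) / T)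
            * bridge (W · ω) (trivialTime T) 0 (bernstein.z k)) • g n k)
          (∑ k, (c n * √((G.τ (n + 1) - G.τ n) / T)
            * bridge (W · ω) (trivialTime T) 0 (bernstein.z k)) • g n k) ∂P := by
  set β : Ω → Fin (M + 1) → ℝ := fun ω k => bridge (W · ω) (trivialTime T) 0 (bernstein.z k) with hβ
  have hl : ∀ ω, A (∑ n : Fin G.N, ∑ k, (c n * bridgeValues G M (W · ω) (n, k)) • g n k)
      (∑ n : Fin G.N, ∑ k, (c n * bridgeValues G M (W · ω) (n, k)) • g n k)
      = ∑ n : Fin G.N, ∑ k, ∑ m : Fin G.N, ∑ l, (c n * c m * A (g m l) (g n k)) *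
          (bridgeValues G M (W · ω) (n, k) * bridgeValues G M (W · ω) (m, l)) := by
    intro ω
    simp only [map_sum, sum_apply, map_smul, smul_apply, smul_eq_mul, Finset.mul_sum]
    refine Finset.sum_congr rfl fun n _ => Finset.sum_congr rfl fun k _ =>
      Finset.sum_congr rfl fun m _ => Finset.sum_congr rfl fun l _ => ?_
    ring
  have hr : ∀ ω, ∑ n : Fin G.N,
        A (∑ k, (c n * √((G.τ (n + 1) - G.τ n) / T) * β ω k) • g n k)
          (∑ k, (c n * √((G.τ (n + 1) - G.τ n) / T) * β ω k) • g n k) = ∑ n : Fin G.N, ∑ k, ∑ l,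
        (c n * c n * A (g n l) (g n k) * ((G.τ (n + 1) - G.τ n) / T)) * (β ω k * β ω l) := by
    intro ω
    refine Finset.sum_congr rfl fun n _ => ?_
    have h0 : √((G.τ (n + 1) - G.τ n) / T) * √((G.τ (n + 1) - G.τ n) / T)
        = (G.τ (n + 1) - G.τ n) / T :=
      Real.mul_self_sqrt (div_nonneg (sub_nonneg.2 (G.τ_lt n n.2).le) hT.le)
    simp only [map_sum, sum_apply, map_smul, smul_apply, smul_eq_mul, Finset.mul_sum]
    refine Finset.sum_congr rfl fun k _ => Finset.sum_congr rfl fun l _ => ?_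
    linear_combination (c n * c n * A (g n l) (g n k) * (β ω k * β ω l)) * h0
  have e1 := integral_congr_ae (ae_of_all P hl)
  have e2 := integral_congr_ae (ae_of_all P hr)
  simp only at e1 e2
  rw [e1, e2]
  have hi : ∀ n k m l, Integrable (fun ω => (c (n : Fin G.N) * c (m : Fin G.N) * A (g m l)
    (g n k)) *
          (bridgeValues G M (W · ω) (n, k) * bridgeValues G M (W · ω) (m, l))) P := fun n k m l =>
    (integrable_bridge_mul_bridge hW _ _ _ _ _).const_mul _
  have hi' : ∀ (n : Fin G.N) k l, Integrable (fun ω =>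
      (c n * c n * A (g n l) (g n k) * ((G.τ (n + 1) - G.τ n) / T)) * (β ω k * β ω l)) P :=
    fun n k l => (integrable_bridge_mul_bridge hW _ _ _ _ _).const_mul _
  rw [integral_finsetSum _ fun n _ => integrable_finsetSum _ fun k _ => integrable_finsetSum _
      fun m _ => integrable_finsetSum _ fun l _ => hi n k m l,
    integral_finsetSum _ fun n _ => integrable_finsetSum _ fun k _ => integrable_finsetSum _
      fun l _ => hi' n k l]
  refine Finset.sum_congr rfl fun n _ => ?_
  rw [integral_finsetSum _ fun k _ => integrable_finsetSum _
      fun m _ => integrable_finsetSum _ fun l _ => hi n k m l,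
    integral_finsetSum _ fun k _ => integrable_finsetSum _ fun l _ => hi' n k l]
  refine Finset.sum_congr rfl fun k _ => ?_
  rw [integral_finsetSum _ fun m _ => integrable_finsetSum _ fun l _ => hi n k m l,
    integral_finsetSum _ fun l _ => hi' n k l, Finset.sum_eq_single n]
  · rw [integral_finsetSum _ fun l _ => hi n k n l]
    refine Finset.sum_congr rfl fun l _ => ?_
    rw [integral_const_mul, integral_const_mul, integral_bridgeValues_mul hT hW, if_pos rfl]
    ring
  · intro m _ hm
    rw [integral_finsetSum _ fun l _ => hi n k m l]
    refine Finset.sum_eq_zero fun l _ => ?_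
    rw [integral_const_mul, integral_bridgeValues_mul hT hW, if_neg hm.symm, mul_zero]
  · simp

/-- After the replacement by one common bridge, the sign argument is applied separately for each
`ω`. The signs may depend on `ω`, since only the bound `R ω`, uniform over all signs, is integrated.
-/
theorem abs_integral_diag_bridgeValues_le (hT : 0 < T) (hW : IsPreBrownianReal W P) {M : ℕ}
    (c : ℕ → ℝ) (A : E →L[ℝ] E →L[ℝ] ℝ) (g : Fin G.N → Fin (M + 1) → E) {R : Ω → ℝ}
    (hR : ∀ᵐ ω ∂P, ∀ ε : Fin G.N → ℝ, (∀ n, |ε n| ≤ 1) →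
      ‖∑ n : Fin G.N, ε n • ∑ k, (c n * √((G.τ (n + 1) - G.τ n) / T)
        * bridge (W · ω) (trivialTime T) 0 (bernstein.z k)) • g n k‖ ≤ R ω)
    (hRi : Integrable (fun ω => R ω ^ 2) P) :
    |∫ ω, A (∑ n : Fin G.N, ∑ k, (c n * bridgeValues G M (W · ω) (n, k)) • g n k)
        (∑ n : Fin G.N, ∑ k, (c n * bridgeValues G M (W · ω) (n, k)) • g n k) ∂P|
      ≤ ‖A‖ * ∫ ω, R ω ^ 2 ∂P := by
  rw [integral_diag_bridgeValues hT hW c A g, ← integral_const_mul, ← Real.norm_eq_abs]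
  refine norm_integral_le_of_norm_le (hRi.const_mul _) ?_
  filter_upwards [hR] with ω h
  exact abs_sum_diag_le A Finset.univ (fun n : Fin G.N => ∑ k, (c n * √((G.τ (n + 1) - G.τ n) / T)
    * bridge (W · ω) (trivialTime T) 0 (bernstein.z k)) • g n k) h

end Trace

/-- The norm of the second derivative of `f` at `x`. -/
def hessianNorm {E : Type*} [NormedAddCommGroup E] [NormedSpace ℝ E] (f : E → ℝ) (x : E) : ℝ :=
  ‖fderiv ℝ (fderiv ℝ f) x‖

theorem hessianNorm_nonneg {E : Type*} [NormedAddCommGroup E] [NormedSpace ℝ E] (f : E → ℝ)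
    (x : E) : 0 ≤ hessianNorm f x := by
  unfold hessianNorm; positivity

theorem bernsteinSum_bridge_zero (w : ℝ≥0 → ℝ) (t : ℕ → ℝ≥0) (n M : ℕ) :
    bernsteinSum M (fun k => bridge w t n (bernstein.z k)) 0 = 0 := by
  have : bernstein.z (0 : Fin (M + 1)) = 0 := by simp
  rw [bernsteinSum_zero, this, bridge_zero]

theorem bernsteinSum_bridge_one {t : ℕ → ℝ≥0} (ht : Monotone t) (w : ℝ≥0 → ℝ) (n M : ℕ) :
    bernsteinSum M (fun k => bridge w t n (bernstein.z k)) 1 = 0 := by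
  rw [bernsteinSum_one]
  rcases eq_or_ne M 0 with rfl | hM
  -- In degree `0` the only node is `0 / 0 = 0`, where the bridge also vanishes.
  · have : bernstein.z (Fin.last 0) = 0 := by simp [bernstein.z]
    rw [this, bridge_zero]
  · rw [bernstein.z_last hM, bridge_one ht]

/-! ### The weak error for frozen Euler nodes. -/

section Conditional

variable {T : ℝ} {G : TimeGrid T} {Ω : Type*} {W : ℝ≥0 → Ω → ℝ} {M : ℕ}

/-- Every interval carries a multiple of the same `B`, which vanishes at both ends. The norm is
therefore the largest multiple times `‖B‖`, whatever the signs and the number of intervals. -/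
theorem norm_signed_transplantedBridge_le (hT : 0 < T) {c : ℕ → ℝ} {S : ℝ}
    (hc : ∀ n < G.N, |c n| ≤ S) {ω : Ω} (h : Continuous (W · ω)) (ε : Fin G.N → ℝ)
    (hε : ∀ n, |ε n| ≤ 1) :
    ‖∑ n : Fin G.N, ε n • ∑ k : Fin (M + 1), (c n * √((G.τ (n + 1) - G.τ n) / T)
        * bridge (W · ω) (trivialTime T) 0 (bernstein.z k)) • (bernstein M k).comp (gridMap G n)‖
      ≤ S * √(G.mesh / T) * (4 * ‖scaledPath W T ω‖) := by
  have hS : 0 ≤ S := (abs_nonneg _).trans (hc 0 (G.N_pos hT))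
  set B := bernsteinSum M fun k => bridge (W · ω) (trivialTime T) 0 (bernstein.z k) with hB
  have hBn : ‖B‖ ≤ 4 * ‖scaledPath W T ω‖ := norm_bernsteinSum_le fun k =>
    abs_bridge_le hT h monotone_trivialTime trivialTime_le _ _
  have hB0 : B 0 = 0 := bernsteinSum_bridge_zero _ _ _ _
  have hB1 : B 1 = 0 := bernsteinSum_bridge_one monotone_trivialTime _ _ _
  let ε' : ℕ → ℝ := fun n => if hn : n < G.N then ε ⟨n, hn⟩ else 0
  have e : ∑ n : Fin G.N, ε n • ∑ k : Fin (M + 1), (c n * √((G.τ (n + 1) - G.τ n) / T)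
        * bridge (W · ω) (trivialTime T) 0 (bernstein.z k)) • (bernstein M k).comp (gridMap G n)
      = ∑ n ∈ Finset.range G.N,
        ((ε' n * (c n * √((G.τ (n + 1) - G.τ n) / T))) • B).comp (gridMap G n) := by
    rw [Finset.sum_range]
    refine Finset.sum_congr rfl fun n _ => ?_
    rw [← comp_gridMap_smul_bernsteinSum]
    have : ε' n = ε n := by simp [ε']
    rw [this]
    ext t
    simp [hB, mul_assoc]
  rw [e]
  refine norm_sum_comp_gridMap_le hT _ (fun n => by simp [hB0]) (fun n => by simp [hB1])
    (by positivity) fun n hn => ?_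
  rw [norm_smul, norm_mul, norm_mul, Real.norm_of_nonneg (Real.sqrt_nonneg _)]
  have h1 : ‖ε' n‖ ≤ 1 := by
    have : ε' n = ε ⟨n, hn⟩ := by simp [ε', hn]
    rw [this]; exact hε _
  have h2 : ‖c n‖ ≤ S := hc n hn
  have h3 : √((G.τ (n + 1) - G.τ n) / T) ≤ √(G.mesh / T) := by
    gcongr
    exact G.sub_le_mesh hn
  calc ‖ε' n‖ * (‖c n‖ * √((G.τ (n + 1) - G.τ n) / T)) * ‖B‖
      ≤ 1 * (S * √(G.mesh / T)) * (4 * ‖scaledPath W T ω‖) := by gcongr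
    _ = _ := by ring

variable [MeasurableSpace Ω] {P : Measure Ω}

/-- The constant in the bound for second order terms of Brownian bridges on a grid. -/
def bridgeConst (P : Measure Ω) (W : ℝ≥0 → Ω → ℝ) (T : ℝ) : ℝ :=
  16 / T * ∫ ω, (1 + ‖scaledPath W T ω‖) ^ 2 ∂P

theorem bridgeConst_nonneg (hT : 0 < T) : 0 ≤ bridgeConst P W T :=
  mul_nonneg (by positivity) (integral_nonneg fun _ => by positivity)

theorem TimeGrid.mesh_nonneg (hT : 0 < T) : 0 ≤ G.mesh :=
  (sub_pos.2 (G.τ_lt 0 (G.N_pos hT))).le.trans (G.sub_le_mesh (G.N_pos hT))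

/-- Squaring the bound `S √(mesh / T) · 4 ‖scaledPath‖` produces the first power of the mesh and the
constant `16 / T`. -/
theorem abs_integral_hessian_pathOfBridge_le [IsProbabilityMeasure P] (hT : 0 < T)
    (hW : IsBrownianReal W P) {c : ℕ → ℝ} {S : ℝ} (hc : ∀ n < G.N, |c n| ≤ S)
    (f : C(Icc (0 : ℝ) T, ℝ) → ℝ) (x : C(Icc (0 : ℝ) T, ℝ)) :
    |∫ ω, fderiv ℝ (fderiv ℝ f) x (pathOfBridge G M c (bridgeValues G M (W · ω)))
        (pathOfBridge G M c (bridgeValues G M (W · ω))) ∂P|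
      ≤ bridgeConst P W T * S ^ 2 * G.mesh * hessianNorm f x := by
  have hi2 := integrable_one_add_norm_scaledPath_pow hW hT 2
  have hm := aemeasurable_norm_scaledPath hW T
  have hsq : ∀ ω, (S * √(G.mesh / T) * (4 * ‖scaledPath W T ω‖)) ^ 2
      = S ^ 2 * (G.mesh / T) * 16 * ‖scaledPath W T ω‖ ^ 2 := by
    intro ω
    rw [mul_pow, mul_pow, Real.sq_sqrt (div_nonneg (G.mesh_nonneg hT) hT.le)]
    ring
  have hle : ∀ ω, ‖scaledPath W T ω‖ ^ 2 ≤ (1 + ‖scaledPath W T ω‖) ^ 2 := fun ω => by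
    gcongr
    linarith
  have hni : Integrable (fun ω => ‖scaledPath W T ω‖ ^ 2) P :=
    hi2.mono' (AEMeasurable.aestronglyMeasurable (by fun_prop)) (ae_of_all _ fun ω => by
      rw [Real.norm_of_nonneg (by positivity)]
      exact hle ω)
  have hRi : Integrable (fun ω => (S * √(G.mesh / T) * (4 * ‖scaledPath W T ω‖)) ^ 2) P := by
    simp only [hsq]
    exact hni.const_mul _
  have h := abs_integral_diag_bridgeValues_le (G := G) hT hW.toIsPreBrownianReal c
    (fderiv ℝ (fderiv ℝ f) x)
    (fun (n : Fin G.N) (k : Fin (M + 1)) => (bernstein M k).comp (gridMap G n))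
    (hW.cont.mono fun ω hω => norm_signed_transplantedBridge_le hT hc hω) hRi
  simp only [pathOfBridge_apply]
  rw [mul_comm _ (hessianNorm f x)]
  refine h.trans (mul_le_mul_of_nonneg_left ?_ (hessianNorm_nonneg f x))
  simp only [hsq]
  rw [integral_const_mul, bridgeConst]
  have h2 : ∫ ω, ‖scaledPath W T ω‖ ^ 2 ∂P ≤ ∫ ω, (1 + ‖scaledPath W T ω‖) ^ 2 ∂P :=
    integral_mono hni hi2 hle
  have h3 : 0 ≤ S ^ 2 * (G.mesh / T) * 16 := by
    have := G.mesh_nonneg hT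
    positivity
  calc _ ≤ S ^ 2 * (G.mesh / T) * 16 * ∫ ω, (1 + ‖scaledPath W T ω‖) ^ 2 ∂P := by gcongr
    _ = _ := by ring

theorem aemeasurable_bridgeValues (hW : IsPreBrownianReal W P) :
    AEMeasurable (fun ω => bridgeValues G M (W · ω)) P :=
  aemeasurable_pi_lambda _ fun _ => (memLp_two_bridge hW _ _ _).aemeasurable

/-- The weak error bound for one smooth functional, conditionally on the values at grid points. -/
theorem abs_integral_pathOfBridge_sub_le [IsProbabilityMeasure P] (hT : 0 < T)
    (hW : IsBrownianReal W P) {c : ℕ → ℝ} {S : ℝ} (hc : ∀ n < G.N, |c n| ≤ S)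
    {f : C(Icc (0 : ℝ) T, ℝ) → ℝ} (hf : ContDiff ℝ 2 f) {K : ℝ} {k : ℕ} (hK : 0 ≤ K)
    (hf0 : ∀ u, |f u| ≤ K * (1 + ‖u‖) ^ k)
    (hf2 : ∀ u, hessianNorm f u ≤ K * (1 + ‖u‖) ^ k) (u : C(Icc (0 : ℝ) T, ℝ)) :
    |∫ x, f (u + pathOfBridge G M c x) ∂(P.map fun ω => bridgeValues G M (W · ω)) - f u|
      ≤ bridgeConst P W T * S ^ 2 * G.mesh * K *
        ∫ x, (1 + ‖u‖ + ‖pathOfBridge G M c x‖) ^ k ∂(P.map fun ω => bridgeValues G M (W · ω)) := by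
  let : MeasurableSpace C(Icc (0 : ℝ) T, ℝ) := borel _
  have : BorelSpace C(Icc (0 : ℝ) T, ℝ) := ⟨rfl⟩
  have hW' := hW.toIsPreBrownianReal
  set κ := P.map fun ω => bridgeValues G M (W · ω) with hκ
  have hbm : AEMeasurable (fun ω => bridgeValues G M (W · ω)) P := aemeasurable_bridgeValues hW'
  have hgl : HasGaussianLaw (fun ω => bridgeValues G M (W · ω)) P :=
    hasGaussianLaw_bridge hW' G.time fun i : Fin G.N × Fin (M + 1) => ((i.1 : ℕ), bernstein.z i.2)
  have : IsGaussian κ := hgl.isGaussian_map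
  set D := pathOfBridge G M c with hD
  have hDm : Measurable D := D.continuous.measurable
  have hmean0 : ∫ x, x ∂κ = 0 := by
    rw [hκ, integral_map hbm (by fun_prop)]
    ext i
    rw [eval_integral (f := fun ω => bridgeValues G M (W · ω))
      fun _ => (memLp_two_bridge hW' _ _ _).integrable (by norm_num)]
    exact integral_bridge hW' _ _ _
  have hmean : ∫ y, y ∂(κ.map D) = 0 := by
    rw [integral_map hDm.aemeasurable (by fun_prop), D.integral_comp_comm
      (φ := fun x => x) IsGaussian.integrable_id,
      hmean0, map_zero]
  have hA : 0 ≤ bridgeConst P W T * S ^ 2 * G.mesh := by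
    have := G.mesh_nonneg hT
    have := bridgeConst_nonneg (P := P) (W := W) hT
    positivity
  have hcd := (hf.fderiv_right (m := 1) (by norm_num)).continuous_fderiv (by norm_num)
  -- The image of the finite-dimensional Gaussian law under the linear map `D` is a centred Gaussian
  -- measure on the path space.
  have h := abs_integral_sub_le_of_trace_le (κ := κ.map D) hmean hf hK hf0 hf2 hA (fun x => by
    rw [integral_map hDm.aemeasurable (Continuous.aestronglyMeasurable (by fun_prop)), hκ,
      integral_map hbm (Continuous.aestronglyMeasurable (by fun_prop))]
    exact abs_integral_hessian_pathOfBridge_le hT hW hc f x) u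
  have hfc := hf.continuous
  rwa [integral_map hDm.aemeasurable (Continuous.aestronglyMeasurable (by fun_prop)),
    integral_map hDm.aemeasurable (Continuous.aestronglyMeasurable (by fun_prop))] at h

end Conditional

/-- A bounded first derivative gives linear growth, by the mean value inequality. -/
theorem SmoothBoundedDerivs.exists_sq_le {g : ℝ → ℝ} (hg : SmoothBoundedDerivs g) :
    ∃ L : ℝ, 1 ≤ L ∧ ∀ y, g y ^ 2 ≤ L ^ 2 * (1 + y ^ 2) := by
  obtain ⟨M, hM⟩ := hg.2 1 le_rfl
  have hd : Differentiable ℝ g := hg.1.differentiable (by simp)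
  have hM0 : 0 ≤ M := (abs_nonneg _).trans (hM 0)
  refine ⟨1 + |g 0| + M, by linarith [abs_nonneg (g 0)], fun y => ?_⟩
  have h := Convex.norm_image_sub_le_of_norm_deriv_le (s := univ) (C := M) (f := g)
    (fun x _ => hd x) (fun x _ => by simpa [iteratedDeriv_one] using hM x) convex_univ
    (mem_univ 0) (mem_univ y)
  rw [Real.norm_eq_abs, Real.norm_eq_abs, sub_zero] at h
  have h1 : |g y| ≤ |g 0| + M * |y| := by
    have := abs_sub_abs_le_abs_sub (g y) (g 0)
    linarith
  have h2 : g y ^ 2 ≤ (|g 0| + M * |y|) ^ 2 := by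
    rw [← sq_abs]; gcongr
  have h3 : (|g 0| + M * |y|) ^ 2 ≤ (|g 0| + M) ^ 2 * (1 + y ^ 2) := by
    rw [← sq_abs y]
    nlinarith [sq_nonneg (|g 0| * |y| - M), abs_nonneg (g 0), abs_nonneg y,
      mul_nonneg (abs_nonneg (g 0)) hM0, mul_nonneg (mul_nonneg (abs_nonneg (g 0)) hM0)
        (sq_nonneg (|y| - 1))]
  refine h2.trans (h3.trans ?_)
  have := abs_nonneg (g 0)
  gcongr ?_ ^ 2 * _
  linarith

theorem abs_le_of_sq_le_mul {L s y : ℝ} (hL : 0 ≤ L) (h : s ^ 2 ≤ L ^ 2 * (1 + y ^ 2)) :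
    |s| ≤ L * (1 + |y|) := by
  refine abs_le_of_sq_le_sq (h.trans ?_) (by positivity)
  rw [mul_pow]
  gcongr
  nlinarith [abs_nonneg y, sq_abs y]

/-! ### Removing the conditioning and passing to the true bridges. -/

section Coupling

variable {Ω : Type*} {T : ℝ} {b σ : ℝ → ℝ} {ξ₀ : ℝ} {W : ℝ≥0 → Ω → ℝ} {G : TimeGrid T}

/-- The increments of `W` over the grid intervals. -/
def gridIncr (W : ℝ≥0 → Ω → ℝ) (G : TimeGrid T) (ω : Ω) (n : ℕ) : ℝ :=
  W (G.time (n + 1)) ω - W (G.time n) ω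

/-- The values of the diffusion coefficient along the Euler recursion driven by `d`. -/
def diffusionOfIncr (b σ : ℝ → ℝ) (ξ₀ : ℝ) (G : TimeGrid T) (d : ℕ → ℝ) (n : ℕ) : ℝ :=
  σ (nodeOfIncr b σ ξ₀ G d n)

/-- The random variable in terms of which all paths under consideration are bounded. -/
def envelope (b σ : ℝ → ℝ) (ξ₀ : ℝ) (W : ℝ≥0 → Ω → ℝ) (G : TimeGrid T) (ω : Ω) : ℝ :=
  (1 + ‖linearOfIncr b σ ξ₀ G (gridIncr W G ω)‖) * (1 + ‖scaledPath W T ω‖)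

theorem one_le_envelope (ω : Ω) : 1 ≤ envelope b σ ξ₀ W G ω :=
  one_le_mul_of_one_le_of_one_le (by linarith [norm_nonneg (linearOfIncr b σ ξ₀ G
    (gridIncr W G ω))])
    (by linarith [norm_nonneg (scaledPath W T ω)])

theorem one_add_norm_linearOfIncr_le_envelope (ω : Ω) :
    1 + ‖linearOfIncr b σ ξ₀ G (gridIncr W G ω)‖ ≤ envelope b σ ξ₀ W G ω :=
  le_mul_of_one_le_right (by positivity) (by linarith [norm_nonneg (scaledPath W T ω)])

theorem norm_pathOfBridge_bridgeValues_le (hT : 0 < T) {c : ℕ → ℝ} {S : ℝ}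
    (hc : ∀ n < G.N, |c n| ≤ S) {ω : Ω} (h : Continuous (W · ω)) (M : ℕ) :
    ‖pathOfBridge G M c (bridgeValues G M (W · ω))‖ ≤ S * (4 * ‖scaledPath W T ω‖) := by
  have hS : 0 ≤ S := (abs_nonneg _).trans (hc 0 (G.N_pos hT))
  have e := pathOfBridge_eq_sum_comp (G := G) (M := M) c
    fun n k => bridge (W · ω) G.time n (bernstein.z k)
  unfold bridgeValues
  rw [e]
  refine norm_sum_comp_gridMap_le hT _ (fun n => ?_) (fun n => ?_) (by positivity) fun n hn => ?_
  · rw [ContinuousMap.smul_apply, bernsteinSum_bridge_zero, smul_zero]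
  · rw [ContinuousMap.smul_apply, bernsteinSum_bridge_one G.monotone_time, smul_zero]
  · rw [norm_smul]
    have h1 : ‖c n‖ ≤ S := hc n hn
    have h2 := norm_bernsteinSum_le (M := M) (x := fun k => bridge (W · ω) G.time n (bernstein.z k))
      fun k => abs_bridge_le hT h G.monotone_time G.time_le n _
    gcongr

theorem tendsto_pathOfBridge_bridgeValues (c : ℕ → ℝ) {ω : Ω} (h : Continuous (W · ω)) :
    Tendsto (fun M => pathOfBridge G M c (bridgeValues G M (W · ω))) atTop
      (𝓝 (∑ n ∈ Finset.range G.N, (c n • bridgePath W G.time n ω).comp (gridMap G n))) := by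
  have e : ∀ M, pathOfBridge G M c (bridgeValues G M (W · ω)) = ∑ n ∈ Finset.range G.N,
      (c n • bernsteinApproximation M (bridgePath W G.time n ω)).comp (gridMap G n) := by
    intro M
    have e := pathOfBridge_eq_sum_comp (G := G) (M := M) c
      fun n k => bridge (W · ω) G.time n (bernstein.z k)
    unfold bridgeValues
    rw [e]
    simp only [bernsteinApproximation_eq_bernsteinSum, bridgePath_apply h]
  simp only [e]
  refine tendsto_finsetSum _ fun n _ => ?_
  exact ((ContinuousMap.continuous_precomp (gridMap G n)).tendsto _).comp
    ((bernsteinApproximation_uniform (bridgePath W G.time n ω)).const_smul (c n))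

theorem abs_diffusionOfIncr_le (hT : 0 < T) {L : ℝ} (hL : 0 ≤ L)
    (hσL : ∀ y, σ y ^ 2 ≤ L ^ 2 * (1 + y ^ 2)) (d : ℕ → ℝ) {n : ℕ} (hn : n < G.N) :
    |diffusionOfIncr b σ ξ₀ G d n| ≤ L * (1 + ‖linearOfIncr b σ ξ₀ G d‖) := by
  refine (abs_le_of_sq_le_mul hL (hσL _)).trans ?_
  have := abs_nodeOfIncr_le (b := b) (σ := σ) (ξ₀ := ξ₀) hT d hn.le
  gcongr

/-- The bound does not depend on the degree `M`; it supplies the dominating function for the limit.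
-/
theorem one_add_norm_add_norm_pathOfBridge_le (hT : 0 < T) {L : ℝ} (hL : 0 ≤ L)
    (hσL : ∀ y, σ y ^ 2 ≤ L ^ 2 * (1 + y ^ 2)) {ω : Ω} (h : Continuous (W · ω)) (M : ℕ) :
    1 + ‖linearOfIncr b σ ξ₀ G (gridIncr W G ω)‖
        + ‖pathOfBridge G M (diffusionOfIncr b σ ξ₀ G (gridIncr W G ω)) (bridgeValues G M (W · ω))‖
      ≤ (1 + 4 * L) * envelope b σ ξ₀ W G ω := by
  have h1 := norm_pathOfBridge_bridgeValues_le (G := G) hT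
    (fun n hn => abs_diffusionOfIncr_le (b := b) (ξ₀ := ξ₀) hT hL hσL (gridIncr W G ω) hn) h M
  refine (add_le_add_right h1 _).trans ?_
  unfold envelope
  have h2 := norm_nonneg (scaledPath W T ω)
  have h3 := norm_nonneg (linearOfIncr b σ ξ₀ G (gridIncr W G ω))
  nlinarith [mul_nonneg h2 h3, mul_nonneg hL h3, mul_nonneg hL h2]

theorem continuous_pathOfBridge_diffusionOfIncr (hb : Continuous b) (hσ : Continuous σ) (M : ℕ) :
    Continuous fun p : (ℕ → ℝ) × (Fin G.N × Fin (M + 1) → ℝ) =>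
      pathOfBridge G M (diffusionOfIncr b σ ξ₀ G p.1) p.2 := by
  have := continuous_nodeOfIncr (ξ₀ := ξ₀) (G := G) hb hσ
  simp only [pathOfBridge_apply, diffusionOfIncr]
  fun_prop

theorem linearPath_eq (hT : 0 < T) (ω : Ω) :
    linearPath b σ ξ₀ W G ω = linearOfIncr b σ ξ₀ G (gridIncr W G ω) :=
  toPath_linearInterp hT fun n hn => by
    rw [gridIncr, G.time_of_le hn, G.time_of_le hn.le]

theorem stochasticPath_eq (hT : 0 < T) {ω : Ω} (h : Continuous (W · ω)) :
    stochasticPath b σ ξ₀ W G ω = linearOfIncr b σ ξ₀ G (gridIncr W G ω)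
      + ∑ n ∈ Finset.range G.N, (diffusionOfIncr b σ ξ₀ G (gridIncr W G ω) n •
        bridgePath W G.time n ω).comp (gridMap G n) := by
  refine toPath_stochasticInterp hT h (fun n hn => ?_) (fun n hn u => ?_)
    (fun n => bridgePath_zero _ _ _) fun n => bridgePath_one G.monotone_time _ _
  · rw [gridIncr, G.time_of_le hn, G.time_of_le hn.le]
  · have e : bridgePoint G.time n u = (G.τ n + u * (G.τ (n + 1) - G.τ n)).toNNReal := by
      rw [← G.coe_time hn, ← G.coe_time hn.le, ← coe_bridgePoint G.monotone_time,
        Real.toNNReal_coe]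
    rw [bridgePath_apply h, bridge, e, G.time_of_le hn.le, gridIncr, G.time_of_le hn.le]

variable [MeasurableSpace Ω] {P : Measure Ω}

theorem aemeasurable_gridIncr (hW : IsPreBrownianReal W P) : AEMeasurable (gridIncr W G) P :=
  aemeasurable_pi_lambda _ fun _ => (memLp_two_sub hW _ _).aemeasurable

theorem aemeasurable_envelope (hb : Continuous b) (hσ : Continuous σ) (hW : IsBrownianReal W P) :
    AEMeasurable (envelope b σ ξ₀ W G) P := by
  have h1 := (continuous_linearOfIncr (ξ₀ := ξ₀) (G := G) hb hσ).norm.measurable.comp_aemeasurable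
    (aemeasurable_gridIncr (G := G) hW.toIsPreBrownianReal)
  have h2 := aemeasurable_norm_scaledPath hW T
  exact (h1.const_add 1).mul (h2.const_add 1)

variable [IsProbabilityMeasure P]

theorem indepFun_gridIncr_bridgeValues (hW : IsPreBrownianReal W P) (M : ℕ) :
    IndepFun (gridIncr W G) (fun ω => bridgeValues G M (W · ω)) P := by
  have h := indepFun_incr_bridge G.monotone_time hW
  exact h.comp (φ := id)
    (ψ := fun y (i : Fin G.N × Fin (M + 1)) => y ((i.1 : ℕ), bernstein.z i.2))
    measurable_id (measurable_pi_lambda _ fun i => measurable_pi_apply _)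

theorem exists_integral_envelope_pow_le (hT : 0 < T) (hW : IsBrownianReal W P) {L : ℝ} (hL : 1 ≤ L)
    (hb : Continuous b) (hσ : Continuous σ) (hbL : ∀ y, b y ^ 2 ≤ L ^ 2 * (1 + y ^ 2))
    (hσL : ∀ y, σ y ^ 2 ≤ L ^ 2 * (1 + y ^ 2)) (ξ₀ : ℝ) (p : ℕ) :
    ∃ C : ℝ, 0 ≤ C ∧ ∀ G : TimeGrid T, G.mesh ≤ 1 →
      Integrable (fun ω => envelope b σ ξ₀ W G ω ^ p) P ∧
        ∫ ω, envelope b σ ξ₀ W G ω ^ p ∂P ≤ C := by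
  have hW' := hW.toIsPreBrownianReal
  obtain ⟨C₁, hC₁, h₁⟩ := exists_lintegral_norm_linearOfIncr_le hT hL hb hσ hbL hσL ξ₀ P (p * 2)
  obtain ⟨C₂, hC₂, h₂⟩ := exists_lintegral_norm_scaledPath_le hW hT (p * 2)
  refine ⟨C₁ + C₂, by positivity, fun G hG => ?_⟩
  -- The two factors of the envelope are not independent, so their product is split by `x y ≤ x² +
  -- y²`; hence the doubled exponents.
  have hle : ∀ ω, envelope b σ ξ₀ W G ω ^ p
      ≤ (1 + ‖linearOfIncr b σ ξ₀ G (gridIncr W G ω)‖) ^ (p * 2)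
        + (1 + ‖scaledPath W T ω‖) ^ (p * 2) := by
    intro ω
    rw [envelope, mul_pow, pow_mul, pow_mul]
    set x := (1 + ‖linearOfIncr b σ ξ₀ G (gridIncr W G ω)‖) ^ p
    set y := (1 + ‖scaledPath W T ω‖) ^ p
    nlinarith [sq_nonneg (x - y), sq_nonneg x, sq_nonneg y]
  have h0 : ∀ ω, 0 ≤ envelope b σ ξ₀ W G ω ^ p := fun ω => by
    have := one_le_envelope (b := b) (σ := σ) (ξ₀ := ξ₀) (W := W) (G := G) ω
    positivity
  have hm : AEMeasurable (fun ω => envelope b σ ξ₀ W G ω ^ p) P :=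
    (aemeasurable_envelope hb hσ hW).pow_const p
  have hm2 : AEMeasurable (fun ω => ENNReal.ofReal ((1 + ‖scaledPath W T ω‖) ^ (p * 2))) P := by
    have := aemeasurable_norm_scaledPath hW T
    fun_prop
  have hint : ∫⁻ ω, ENNReal.ofReal (envelope b σ ξ₀ W G ω ^ p) ∂P ≤ ENNReal.ofReal (C₁ + C₂) := by
    calc ∫⁻ ω, ENNReal.ofReal (envelope b σ ξ₀ W G ω ^ p) ∂P
        ≤ ∫⁻ ω, (ENNReal.ofReal ((1 + ‖linearOfIncr b σ ξ₀ G (gridIncr W G ω)‖) ^ (p * 2))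
            + ENNReal.ofReal ((1 + ‖scaledPath W T ω‖) ^ (p * 2))) ∂P := by
          refine lintegral_mono fun ω => ?_
          rw [← ENNReal.ofReal_add (by positivity) (by positivity)]
          exact ENNReal.ofReal_le_ofReal (hle ω)
      _ = _ := lintegral_add_right' _ hm2
      _ ≤ ENNReal.ofReal C₁ + ENNReal.ofReal C₂ := by
          refine add_le_add (h₁ G (fun n ω => gridIncr W G ω n) hG ?_ ?_ ?_) h₂
          · exact hW'.hasIndepIncrements.nat G.monotone_time
          · exact fun n => (memLp_two_sub hW' _ _).aemeasurable
          · exact fun n hn => map_incr_eq_gaussianReal hW' G hn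
      _ = _ := (ENNReal.ofReal_add hC₁ hC₂).symm
  refine ⟨⟨hm.aestronglyMeasurable, ?_⟩, ?_⟩
  · rw [hasFiniteIntegral_iff_ofReal (ae_of_all _ h0)]
    exact hint.trans_lt ENNReal.ofReal_lt_top
  · rw [integral_eq_lintegral_of_nonneg_ae (ae_of_all _ h0) hm.aestronglyMeasurable]
    exact ENNReal.toReal_le_of_le_ofReal (by positivity) hint

/-- The weak error bound with the bridges replaced by their Bernstein approximations. -/
theorem abs_integral_bernstein_sub_le (hT : 0 < T) (hW : IsBrownianReal W P) {L : ℝ} (hL : 1 ≤ L)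
    (hb : Continuous b) (hσ : Continuous σ) (hσL : ∀ y, σ y ^ 2 ≤ L ^ 2 * (1 + y ^ 2))
    {f : C(Icc (0 : ℝ) T, ℝ) → ℝ} (hf : ContDiff ℝ 2 f) {K : ℝ} {k : ℕ} (hK : 0 ≤ K)
    (hf0 : ∀ u, |f u| ≤ K * (1 + ‖u‖) ^ k) (hf2 : ∀ u, hessianNorm f u ≤ K * (1 + ‖u‖) ^ k)
    (hint : Integrable (fun ω => envelope b σ ξ₀ W G ω ^ (k + 2)) P) (M : ℕ) :
    |∫ ω, (f (linearOfIncr b σ ξ₀ G (gridIncr W G ω) + pathOfBridge G M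
          (diffusionOfIncr b σ ξ₀ G (gridIncr W G ω)) (bridgeValues G M (W · ω)))
        - f (linearOfIncr b σ ξ₀ G (gridIncr W G ω))) ∂P|
      ≤ bridgeConst P W T * L ^ 2 * G.mesh * K * (1 + 4 * L) ^ k *
        ∫ ω, envelope b σ ξ₀ W G ω ^ (k + 2) ∂P := by
  have hW' := hW.toIsPreBrownianReal
  have hL0 : 0 ≤ L := zero_le_one.trans hL
  have hX := aemeasurable_gridIncr (G := G) hW'
  have hV := aemeasurable_bridgeValues (G := G) (M := M) hW'
  set X := gridIncr W G with hXdef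
  set V := fun ω => bridgeValues G M (W · ω) with hVdef
  have hXV : AEMeasurable (fun ω => (X ω, V ω)) P := hX.prodMk hV
  have hlaw : P.map (fun ω => (X ω, V ω)) = (P.map X).prod (P.map V) :=
    (indepFun_iff_map_prod_eq_prod_map_map hX hV).1 (indepFun_gridIncr_bridgeValues hW' M)
  have : IsProbabilityMeasure (P.map X) := Measure.isProbabilityMeasure_map hX
  have : IsProbabilityMeasure (P.map V) := Measure.isProbabilityMeasure_map hV
  have hcY := continuous_linearOfIncr (ξ₀ := ξ₀) (G := G) hb hσ
  have hcY' : Continuous fun p : (ℕ → ℝ) × (Fin G.N × Fin (M + 1) → ℝ) =>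
    linearOfIncr b σ ξ₀ G p.1 := hcY.comp continuous_fst
  have hcD := continuous_pathOfBridge_diffusionOfIncr (ξ₀ := ξ₀) (G := G) hb hσ M
  have hcf := hf.continuous
  let Y := linearOfIncr b σ ξ₀ G
  let D := fun p : (ℕ → ℝ) × (Fin G.N × Fin (M + 1) → ℝ) =>
    pathOfBridge G M (diffusionOfIncr b σ ξ₀ G p.1) p.2
  -- The square comes from the diffusion coefficient, which enters the second order term
  -- quadratically and grows linearly; the power `k` comes from the growth of `f` and its second
  -- derivative.
  let H := fun p : (ℕ → ℝ) × (Fin G.N × Fin (M + 1) → ℝ) =>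
    (1 + ‖Y p.1‖) ^ 2 * (1 + ‖Y p.1‖ + ‖D p‖) ^ k
  let F := fun p : (ℕ → ℝ) × (Fin G.N × Fin (M + 1) → ℝ) => f (Y p.1 + D p)
  have hcH : Continuous H := by fun_prop
  have hcF : Continuous F := by fun_prop
  have hH0 : ∀ p, 0 ≤ H p := fun p => by positivity
  have hHle : ∀ᵐ ω ∂P, H (X ω, V ω) ≤ (1 + 4 * L) ^ k * envelope b σ ξ₀ W G ω ^ (k + 2) := by
    filter_upwards [hW.cont] with ω h
    have h1 := one_add_norm_add_norm_pathOfBridge_le (b := b) (ξ₀ := ξ₀) (G := G) hT hL0 hσL h M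
    have h2 := one_add_norm_linearOfIncr_le_envelope (b := b) (σ := σ) (ξ₀ := ξ₀) (W := W)
      (G := G) ω
    have h3 := one_le_envelope (b := b) (σ := σ) (ξ₀ := ξ₀) (W := W) (G := G) ω
    calc H (X ω, V ω) ≤ envelope b σ ξ₀ W G ω ^ 2 * ((1 + 4 * L) * envelope b σ ξ₀ W G ω) ^ k :=
          mul_le_mul (pow_le_pow_left₀ (by positivity) h2 2) (pow_le_pow_left₀ (by positivity) h1 k)
            (by positivity) (by positivity)
      _ = _ := by rw [mul_pow]; ring
  have hHP : Integrable (fun ω => H (X ω, V ω)) P :=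
    (hint.const_mul _).mono' (hcH.measurable.comp_aemeasurable hXV).aestronglyMeasurable
      (hHle.mono fun ω h => by rwa [Real.norm_of_nonneg (hH0 _)])
  have hHprod : Integrable H ((P.map X).prod (P.map V)) := by
    rw [← hlaw]
    exact (integrable_map_measure hcH.aestronglyMeasurable hXV).2 hHP
  have hFle : ∀ p, ‖F p‖ ≤ K * H p := fun p => by
    refine (hf0 _).trans (mul_le_mul_of_nonneg_left ?_ hK)
    have h1 : 1 + ‖Y p.1 + D p‖ ≤ 1 + ‖Y p.1‖ + ‖D p‖ := by linarith [norm_add_le (Y p.1) (D p)]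
    refine (pow_le_pow_left₀ (by positivity) h1 k).trans ?_
    refine le_mul_of_one_le_left (by positivity) (one_le_pow₀ ?_)
    linarith [norm_nonneg (Y p.1)]
  have hFprod : Integrable F ((P.map X).prod (P.map V)) :=
    (hHprod.const_mul K).mono' hcF.aestronglyMeasurable (ae_of_all _ hFle)
  have hfYle : ∀ p, ‖f (Y p.1)‖ ≤ K * H p := fun p => by
    refine (hf0 _).trans (mul_le_mul_of_nonneg_left ?_ hK)
    have h1 : 1 + ‖Y p.1‖ ≤ 1 + ‖Y p.1‖ + ‖D p‖ := by linarith [norm_nonneg (D p)]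
    refine (pow_le_pow_left₀ (by positivity) h1 k).trans ?_
    refine le_mul_of_one_le_left (by positivity) (one_le_pow₀ ?_)
    linarith [norm_nonneg (Y p.1)]
  have hfYc : Continuous fun p : (ℕ → ℝ) × (Fin G.N × Fin (M + 1) → ℝ) => f (Y p.1) := by fun_prop
  have hfYprod : Integrable (fun p : (ℕ → ℝ) × (Fin G.N × Fin (M + 1) → ℝ) => f (Y p.1))
      ((P.map X).prod (P.map V)) :=
    (hHprod.const_mul K).mono' hfYc.aestronglyMeasurable (ae_of_all _ hfYle)
  -- Conditioning on the grid increments is Fubini's theorem for the product law of `X` and `V`.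
  have e1 : ∫ ω, (f (Y (X ω) + D (X ω, V ω)) - f (Y (X ω))) ∂P
      = ∫ d, (∫ x, F (d, x) ∂(P.map V) - f (Y d)) ∂(P.map X) := by
    rw [← integral_map (φ := fun ω => (X ω, V ω)) hXV
      (f := fun p => F p - f (Y p.1)) (hcF.sub hfYc).aestronglyMeasurable, hlaw,
      integral_prod (fun p => F p - f (Y p.1)) (hFprod.sub hfYprod)]
    refine integral_congr_ae ?_
    filter_upwards [hFprod.prod_right_ae] with d hd
    rw [integral_sub hd (integrable_const _)]
    simp
  have hbd : ∀ d, ‖∫ x, F (d, x) ∂(P.map V) - f (Y d)‖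
      ≤ bridgeConst P W T * L ^ 2 * G.mesh * K * ∫ x, H (d, x) ∂(P.map V) := by
    intro d
    refine (abs_integral_pathOfBridge_sub_le hT hW
      (fun n hn => abs_diffusionOfIncr_le (b := b) (ξ₀ := ξ₀) hT hL0 hσL d hn)
      hf hK hf0 hf2 (Y d)).trans (le_of_eq ?_)
    simp only [H]
    rw [integral_const_mul]
    ring
  have hA : 0 ≤ bridgeConst P W T * L ^ 2 * G.mesh * K := by
    have := G.mesh_nonneg hT
    have := bridgeConst_nonneg (P := P) (W := W) hT
    positivity
  change |∫ ω, (f (Y (X ω) + D (X ω, V ω)) - f (Y (X ω))) ∂P| ≤ _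
  rw [e1, ← Real.norm_eq_abs]
  refine (norm_integral_le_of_norm_le (hHprod.integral_prod_left.const_mul _)
    (ae_of_all _ hbd)).trans ?_
  rw [integral_const_mul, ← integral_prod _ hHprod, ← hlaw,
    integral_map hXV hcH.aestronglyMeasurable, mul_assoc _ ((1 + 4 * L) ^ k),
    ← integral_const_mul ((1 + 4 * L) ^ k)]
  exact mul_le_mul_of_nonneg_left (integral_mono_ae hHP (hint.const_mul _) hHle) hA

/-- The weak error bound on a single grid. -/
theorem weakError_le (hT : 0 < T) (hW : IsBrownianReal W P) {L : ℝ} (hL : 1 ≤ L)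
    (hb : Continuous b) (hσ : Continuous σ) (hσL : ∀ y, σ y ^ 2 ≤ L ^ 2 * (1 + y ^ 2))
    {f : C(Icc (0 : ℝ) T, ℝ) → ℝ} (hf : ContDiff ℝ 2 f) {K : ℝ} {k : ℕ} (hK : 0 ≤ K)
    (hf0 : ∀ u, |f u| ≤ K * (1 + ‖u‖) ^ k) (hf2 : ∀ u, hessianNorm f u ≤ K * (1 + ‖u‖) ^ k)
    (hint : Integrable (fun ω => envelope b σ ξ₀ W G ω ^ (k + 2)) P) :
    Integrable (fun ω => f (linearPath b σ ξ₀ W G ω)) P ∧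
      Integrable (fun ω => f (stochasticPath b σ ξ₀ W G ω)) P ∧
      |∫ ω, (f (linearPath b σ ξ₀ W G ω) - f (stochasticPath b σ ξ₀ W G ω)) ∂P|
        ≤ bridgeConst P W T * L ^ 2 * G.mesh * K * (1 + 4 * L) ^ k *
          ∫ ω, envelope b σ ξ₀ W G ω ^ (k + 2) ∂P := by
  have hW' := hW.toIsPreBrownianReal
  have hL0 : 0 ≤ L := zero_le_one.trans hL
  have hX := aemeasurable_gridIncr (G := G) hW'
  have hcY := continuous_linearOfIncr (ξ₀ := ξ₀) (G := G) hb hσ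
  have hcf := hf.continuous
  let Y := fun ω => linearOfIncr b σ ξ₀ G (gridIncr W G ω)
  let D := fun M ω => pathOfBridge G M (diffusionOfIncr b σ ξ₀ G (gridIncr W G ω))
    (bridgeValues G M (W · ω))
  have hYm : AEStronglyMeasurable (fun ω => f (Y ω)) P :=
    ((hcf.comp hcY).measurable.comp_aemeasurable hX).aestronglyMeasurable
  have hDm : ∀ M, AEStronglyMeasurable (fun ω => f (Y ω + D M ω)) P := fun M => by
    have hV := aemeasurable_bridgeValues (G := G) (M := M) hW'
    have hcD := continuous_pathOfBridge_diffusionOfIncr (ξ₀ := ξ₀) (G := G) hb hσ M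
    have hc : Continuous fun p : (ℕ → ℝ) × (Fin G.N × Fin (M + 1) → ℝ) =>
        f (linearOfIncr b σ ξ₀ G p.1 + pathOfBridge G M (diffusionOfIncr b σ ξ₀ G p.1) p.2) :=
      hcf.comp ((hcY.comp continuous_fst).add hcD)
    exact (hc.measurable.comp_aemeasurable (hX.prodMk hV)).aestronglyMeasurable
  let E := fun ω => K * ((1 + 4 * L) ^ k * envelope b σ ξ₀ W G ω ^ (k + 2))
  have hE : Integrable E P := (hint.const_mul _).const_mul _
  have hpow : ∀ ω (u : C(Icc (0 : ℝ) T, ℝ)), 1 + ‖u‖ ≤ (1 + 4 * L) * envelope b σ ξ₀ W G ω →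
      ‖f u‖ ≤ E ω := by
    intro ω u hu
    have h3 := one_le_envelope (b := b) (σ := σ) (ξ₀ := ξ₀) (W := W) (G := G) ω
    refine (hf0 u).trans (mul_le_mul_of_nonneg_left ?_ hK)
    refine (pow_le_pow_left₀ (by positivity) hu k).trans ?_
    rw [mul_pow]
    exact mul_le_mul_of_nonneg_left (pow_le_pow_right₀ h3 (by omega)) (by positivity)
  have hYle : ∀ ω, ‖f (Y ω)‖ ≤ E ω := fun ω => hpow ω _
    ((one_add_norm_linearOfIncr_le_envelope ω).trans (le_mul_of_one_le_left
      (zero_le_one.trans (one_le_envelope ω)) (by linarith)))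
  have hDle : ∀ M, ∀ᵐ ω ∂P, ‖f (Y ω + D M ω)‖ ≤ E ω := fun M => by
    filter_upwards [hW.cont] with ω h
    refine hpow ω _ (le_trans ?_
      (one_add_norm_add_norm_pathOfBridge_le (b := b) (ξ₀ := ξ₀) (G := G) hT hL0 hσL h M))
    linarith [norm_add_le (Y ω) (D M ω)]
  have hlim : ∀ᵐ ω ∂P, Tendsto (fun M => f (Y ω + D M ω)) atTop
      (𝓝 (f (stochasticPath b σ ξ₀ W G ω))) := by
    filter_upwards [hW.cont] with ω h
    rw [stochasticPath_eq hT h]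
    exact (hcf.tendsto _).comp ((tendsto_pathOfBridge_bridgeValues _ h).const_add _)
  have hYi : Integrable (fun ω => f (Y ω)) P := hE.mono' hYm (ae_of_all _ hYle)
  -- Measurability of the stochastic interpolation is inherited from the approximations, which
  -- involve finitely many values of `W`.
  have hXm : AEStronglyMeasurable (fun ω => f (stochasticPath b σ ξ₀ W G ω)) P :=
    aestronglyMeasurable_of_tendsto_ae atTop hDm hlim
  have hXi : Integrable (fun ω => f (stochasticPath b σ ξ₀ W G ω)) P := by
    refine hE.mono' hXm ?_
    filter_upwards [hlim, ae_all_iff.2 hDle] with ω h1 h2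
    exact le_of_tendsto h1.norm (Eventually.of_forall h2)
  have hIlim : Tendsto (fun M => |∫ ω, (f (Y ω + D M ω) - f (Y ω)) ∂P|) atTop
      (𝓝 |∫ ω, (f (stochasticPath b σ ξ₀ W G ω) - f (Y ω)) ∂P|) := by
    refine (tendsto_integral_of_dominated_convergence (fun ω => E ω + E ω)
      (fun M => (hDm M).sub hYm) (hE.add hE) (fun M => ?_) ?_).abs
    · filter_upwards [hDle M] with ω h
      exact (norm_sub_le _ _).trans (add_le_add h (hYle ω))
    · filter_upwards [hlim] with ω h
      exact h.sub_const _
  have hYeq : ∀ ω, linearPath b σ ξ₀ W G ω = Y ω := fun ω => linearPath_eq hT ω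
  simp only [hYeq]
  refine ⟨hYi, hXi, ?_⟩
  rw [integral_sub hYi hXi, abs_sub_comm, ← integral_sub hXi hYi]
  exact le_of_tendsto hIlim (Eventually.of_forall fun M =>
    abs_integral_bernstein_sub_le hT hW hL hb hσ hσL hf hK hf0 hf2 hint M)

end Coupling

end EulerWeak

end

/-! ### The weak error estimate. -/

theorem proposition8p3 {Ω : Type*} [MeasurableSpace Ω] (P : Measure Ω) [IsProbabilityMeasure P]
    (W : ℝ≥0 → Ω → ℝ) (hW : IsBrownianReal W P)
    (T : ℝ) (hT : 0 < T)
    (b σ : ℝ → ℝ) (hbσ : EulerWeak.CoefficientAssumption b σ) (ξ₀ : ℝ)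
    (f : C(Set.Icc (0 : ℝ) T, ℝ) → ℝ) (hf : EulerWeak.PolyGrowthContDiff 2 f) :
    ∃ C : ℝ, 0 < C ∧ ∀ G : EulerWeak.TimeGrid T, G.mesh ∈ Set.Ioc (0 : ℝ) 1 →
      Integrable (fun ω => f (EulerWeak.linearPath b σ ξ₀ W G ω)) P ∧
      Integrable (fun ω => f (EulerWeak.stochasticPath b σ ξ₀ W G ω)) P ∧
      |∫ ω, (f (EulerWeak.linearPath b σ ξ₀ W G ω)
          - f (EulerWeak.stochasticPath b σ ξ₀ W G ω)) ∂P| ≤ C * G.mesh := by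
  obtain ⟨L₁, hL₁, hb⟩ := hbσ.drift.exists_sq_le
  obtain ⟨L₂, hL₂, hσ⟩ := hbσ.diffusion.exists_sq_le
  have hL : 1 ≤ max L₁ L₂ := hL₁.trans (le_max_left _ _)
  set L := max L₁ L₂ with hLdef
  have hbL : ∀ y, b y ^ 2 ≤ L ^ 2 * (1 + y ^ 2) := fun y => (hb y).trans (by
    have := le_max_left L₁ L₂
    gcongr)
  have hσL : ∀ y, σ y ^ 2 ≤ L ^ 2 * (1 + y ^ 2) := fun y => (hσ y).trans (by
    have := le_max_right L₁ L₂
    gcongr)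
  have hbc := hbσ.drift.1.continuous
  have hσc := hbσ.diffusion.1.continuous
  obtain ⟨K, k, hK, hf0, hf2⟩ := hf.exists_pow_bound
  obtain ⟨C, hC, hQ⟩ :=
    EulerWeak.exists_integral_envelope_pow_le hT hW hL hbc hσc hbL hσL ξ₀ (k + 2)
  have hB := EulerWeak.bridgeConst_nonneg (P := P) (W := W) hT
  -- The summand `1` only makes the constant strictly positive.
  refine ⟨EulerWeak.bridgeConst P W T * L ^ 2 * K * (1 + 4 * L) ^ k * C + 1, by positivity,
    fun G hG => ?_⟩
  obtain ⟨hi, hle⟩ := hQ G hG.2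
  obtain ⟨h1, h2, h3⟩ := EulerWeak.weakError_le hT hW hL hbc hσc hσL hf.1 hK hf0 hf2 hi
  refine ⟨h1, h2, h3.trans ?_⟩
  have hG0 := hG.1.le
  calc _ ≤ EulerWeak.bridgeConst P W T * L ^ 2 * G.mesh * K * (1 + 4 * L) ^ k * C := by gcongr
    _ ≤ _ := by linarith
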